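/- Let $p>1$ and let $\sigma_p$ be the measure on $\mathbb{R}^2$ given by $d\sigma_p(y,s)=\delta(s-|y|^p)\,|y|^{\frac{p-2}{6}}\,dy\,ds$, i.e. the image of $|y|^{\frac{p-2}{6}}dy$ under $y\mapsto(y,|y|^p)$. For $f\in L^2(\mathbb{R})$ (complex valued), $f\sigma_p$ denotes the measure $f(y)\,d\sigma_p(y,s)$. A sequence $(f_n)\subset L^2(\mathbb{R})$ is said to concentrate at $y_0\in\mathbb{R}$ if for every $\varepsilon,\rho>0$ there is $N$ such that for all $n\ge N$ $$\int_{|y-y_0|\ge\rho}|f_n(y)|^2\,dy<\varepsilon\,\|f_n\|_{L^2(\mathbb{R})}^2 .$$ Let $y_0\in\mathbb{R}\setminus\{0\}$. If $(f_n)\subset L^2(\mathbb{R})$ concentrates at $y_0$, then $$\limsup_{n\to\infty}\frac{\|f_n\sigma_p*f_n\sigma_p*f_n\sigma_p\|_{L^2(\mathbb{R}^2)}^2}{\|f_n\|_{L^2(\mathbb{R})}^6}\le\frac{2\pi}{\sqrt3\,p(p-1)}.\qquad(\ast)$$ Moreover, for $n\ge1$ set $$f_n(y)=e^{-n\left(|y|^p-|y_0|^p-p\,y_0|y_0|^{p-2}(y-y_0)\right)}\,|y|^{\frac{p-2}{6}}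 .$$ Then $0\neq f_n\in L^2(\mathbb{R})$ for every $n\ge1$, the sequence $\big(f_n\|f_n\|_{L^2}^{-1}\big)_{n\ge1}$ concentrates at $y_0$, and for it equality holds in $(\ast)$. -/

import Mathlib

open MeasureTheory Filter

noncomputable section

/-- The singular measure `dσ_p(y,s) = δ(s - |y|^p) |y|^((p-2)/6) dy ds` on the plane: the image
of the measure `|y|^((p-2)/6) dy` on the line under the parametrization `y ↦ (y, |y|^p)`. -/
def sigmaMeasure (p : ℝ) : Measure (ℝ × ℝ) :=
  ((volume : Measure ℝ).withDensity (fun y => ENNReal.ofReal (|y| ^ ((p - 2) / 6)))).map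
    (fun y => (y, |y| ^ p))

instance sigmaMeasure_sFinite (p : ℝ) : SFinite (sigmaMeasure p) := by
  unfold sigmaMeasure; infer_instance

/-- The locally integrable function `g` is the Lebesgue density of the triple convolution
`fσ_p * fσ_p * fσ_p`, where `fσ_p` is the (locally finite, complex) measure `f(y) dσ_p(y,s)`.
Integrating a test function `φ ∈ C_c(ℝ²)` against the convolution means integrating
`φ(z₁ + z₂ + z₃)` against the product of the three measures; this integral converges absolutely
for `f ∈ L²(ℝ)`, because `σ_p` is carried by a curve on which `s = |y|^p ≥ 0`. -/
structure IsTripleConvDensity (p : ℝ) (f : ℝ → ℂ) (g : ℝ × ℝ → ℂ) : Prop where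
  locallyIntegrable : LocallyIntegrable g volume
  integral_eq : ∀ φ : ℝ × ℝ → ℂ, Continuous φ → HasCompactSupport φ →
    ∫ x, φ x * g x =
      ∫ z : (ℝ × ℝ) × (ℝ × ℝ) × (ℝ × ℝ),
        φ (z.1 + z.2.1 + z.2.2) * (f z.1.1 * f z.2.1.1 * f z.2.2.1)
        ∂((sigmaMeasure p).prod ((sigmaMeasure p).prod (sigmaMeasure p)))

/-- The norm `‖fσ_p * fσ_p * fσ_p‖` in `L²(ℝ²)`. The density is unique up to null sets, so the
infimum is over a single value, or it is `∞` if the convolution has no density. -/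
def tripleConvNorm (p : ℝ) (f : ℝ → ℂ) : ENNReal :=
  ⨅ (g : ℝ × ℝ → ℂ) (_ : IsTripleConvDensity p f g), eLpNorm g 2 volume

/-- The quotient `‖fσ_p * fσ_p * fσ_p‖² / ‖f‖⁶` of `L²` norms. -/
def convRatio (p : ℝ) (f : ℝ → ℂ) : ENNReal :=
  tripleConvNorm p f ^ 2 / eLpNorm f 2 volume ^ 6

/-- The sequence `f` of functions in `L²(ℝ)` concentrates at the point `y₀`. -/
structure ConcentratesAt (f : ℕ → ℝ → ℂ) (y₀ : ℝ) : Prop where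
  memLp : ∀ n, MemLp (f n) 2 volume
  concentrates : ∀ ε > (0 : ℝ), ∀ ρ > (0 : ℝ), ∃ N : ℕ, ∀ n ≥ N,
    ∫ y in {y : ℝ | ρ ≤ |y - y₀|}, ‖f n y‖ ^ 2 < ε * ∫ y, ‖f n y‖ ^ 2

/-- `y ↦ exp(-n (|y|^p - |y₀|^p - p y₀ |y₀|^(p-2) (y - y₀))) |y|^((p-2)/6)`. -/
def trialFunction (p y₀ : ℝ) (n : ℕ) (y : ℝ) : ℂ :=
  ((Real.exp (-(n : ℝ) * (|y| ^ p - |y₀| ^ p - p * y₀ * |y₀| ^ (p - 2) * (y - y₀)))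
    * |y| ^ ((p - 2) / 6) : ℝ) : ℂ)

/-- `f / ‖f‖`, with the norm of `L²(ℝ)`. -/
def l2Normalize (f : ℝ → ℂ) (y : ℝ) : ℂ :=
  f y * (((eLpNorm f 2 volume).toReal⁻¹ : ℝ) : ℂ)

end

/-!
The quotient is controlled by the density of a threefold convolution of positive measures. Write
`W(y) = ∏ |yᵢ|^((p-2)/6)` and `π(y) = (∑ yᵢ, ∑ |yᵢ|^p)` for `y ∈ ℝ³`. Tested against `φ`, the triple
convolution is `∫ φ(π y) W(y) f(y₁) f(y₂) f(y₃) dy`. By the Cauchy-Schwarz inequality its square is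
at most `∫ |f(y₁) f(y₂) f(y₃)|² dy · ∫ W² |φ ∘ π|² dy`. If the image of `W² dy` under `π` has density
at most `C`, this is at most `C ‖f‖⁶ ‖φ‖²`, and the Riesz representation theorem gives a square
integrable density of the convolution, of squared norm at most `C ‖f‖⁶`
(`setLIntegral_enorm_sq_le`, `exists_density_of_bound`).

Near the point `3 (y₀, |y₀|^p)` the density is computed in cylindrical coordinates around the
diagonal of `ℝ³`, `y = ξ/3 + r u(θ)` with `dy = 3^(-1/2) r dξ dθ dr`. The height `t = ∑ |yᵢ|^p`
has radial derivative close to `p (p-1) |y₀|^(p-2) r`, and `W²` is close to `|y₀|^(p-2)`, so that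
`W² r dr` is close to `dt / (p (p-1))`. Integration in `θ` gives the constant `2π / (√3 p (p-1))`,
as an upper bound (`IsWindow.setLIntegral_le`), and as a lower bound next to the lower edge of the
range of `π` (`exists_lintegral_edgeRegion_le`).

For the part of `f` away from `y₀`, which is small in `L²` but not in support, the density
has to be bounded globally (`exists_lintegral_curveSum_le`). For `p ≥ 2` the radial derivative
dominates `r W²` everywhere. For `p < 2` the weight is singular where a coordinate vanishes. Order
the coordinates by absolute value. If `(y₂ - y₃)² ≤ |y₁| |y₃|`, then the quotient of `r W²` by the
radial derivative is at most a multiple of `|sin θ|^(-2q) + 1`, `q = (2-p)/3 < 1/3`, which is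
integrable in `θ`. Otherwise `(y₁, ξ, t)` serve as coordinates: their Jacobian is at least of size
`|y₂ - y₃| |y₃|^(p-2)`, and the quotient has an integrable singularity `|y₁|^(-q-1/2)`.

For the trial functions the product `f(y₁) f(y₂) f(y₃)` equals `W` times a function `a` of `π(y)`,
since the exponent is affine along the curve. Testing against `a`, restricted to the region where
the density is bounded below, turns the Cauchy-Schwarz inequality into an asymptotic equality
(`le_tripleConvNorm_sq`), as Laplace's principle puts almost all of the mass there.
-/

/-! ### The odd power `|x|^(p-2) x` -/

/-- The odd power `|x|^(p-2) x`, that is, the derivative of `|x|^p / p`. -/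
noncomputable def oddPow (p x : ℝ) : ℝ := |x| ^ (p - 2) * x

lemma oddPow_neg (p x : ℝ) : oddPow p (-x) = -oddPow p x := by
  simp [oddPow]

lemma oddPow_of_nonneg {p x : ℝ} (hp : 1 < p) (hx : 0 ≤ x) : oddPow p x = x ^ (p - 1) := by
  rcases hx.eq_or_lt with rfl | hx
  · simp [oddPow, Real.zero_rpow (by linarith : p - 1 ≠ 0)]
  · rw [oddPow, abs_of_pos hx, ← Real.rpow_add_one hx.ne']
    congr 1; ring

lemma hasDerivAt_abs_rpow_oddPow {p : ℝ} (hp : 1 < p) (x : ℝ) :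
    HasDerivAt (fun x : ℝ => |x| ^ p) (p * oddPow p x) x := by
  have := hasDerivAt_abs_rpow x hp
  rwa [mul_assoc] at this

lemma hasDerivAt_oddPow {p x : ℝ} (hx : x ≠ 0) :
    HasDerivAt (oddPow p) ((p - 1) * |x| ^ (p - 2)) x := by
  have h1 : HasDerivAt (fun x : ℝ => |x|) (SignType.sign x : ℝ) x := hasDerivAt_abs hx
  have h2 := (h1.rpow_const (p := p - 2) (Or.inl (abs_ne_zero.2 hx))).mul (hasDerivAt_id x)
  refine h2.congr_deriv ?_
  have h3 : |x| ^ (p - 2 - 1) * |x| = |x| ^ (p - 2) := by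
    rw [← Real.rpow_add_one (abs_ne_zero.2 hx)]; congr 1; ring
  have h4 : (SignType.sign x : ℝ) * x = |x| := by
    rw [mul_comm]; exact self_mul_sign x
  simp only [id]
  linear_combination (p - 2) * |x| ^ (p - 2 - 1) * h4 + (p - 2) * h3

lemma oddPow_sub_ge {p a b : ℝ} (hp : 1 < p) (ha : 0 < a) (hb : |b| ≤ a) :
    min (p - 1) (1 / 2) * (a - b) * a ^ (p - 2) ≤ oddPow p a - oddPow p b := by
  have hA : 0 < a ^ (p - 2) := Real.rpow_pos_of_pos ha _
  have hpa : oddPow p a = a ^ (p - 2) * a := by rw [oddPow, abs_of_pos ha]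
  have hab : 0 ≤ a - b := by linarith [le_abs_self b]
  rcases le_total 2 p with h2 | h2
  · have hle : |b| ^ (p - 2) ≤ a ^ (p - 2) :=
      Real.rpow_le_rpow (abs_nonneg _) hb (by linarith)
    have h0 : (0 : ℝ) ≤ |b| ^ (p - 2) := by positivity
    have hmin : min (p - 1) (1 / 2) * (a - b) * a ^ (p - 2) ≤ 1 / 2 * (a - b) * a ^ (p - 2) := by
      gcongr; exact min_le_right _ _
    refine hmin.trans ?_
    rw [hpa, oddPow]
    rcases le_total 0 b with hb0 | hb0
    · nlinarith [mul_le_mul_of_nonneg_right hle hb0, mul_nonneg hab hA.le]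
    · rw [abs_of_nonpos hb0] at hb h0 ⊢
      nlinarith [mul_nonneg h0 (neg_nonneg.2 hb0), mul_nonneg hA.le (by linarith : 0 ≤ a + b)]
  · have hmin : min (p - 1) (1 / 2) * (a - b) * a ^ (p - 2) ≤ (p - 1) * (a - b) * a ^ (p - 2) := by
      gcongr; exact min_le_left _ _
    refine hmin.trans ?_
    rcases le_total 0 b with hb0 | hb0
    · rw [hpa, oddPow_of_nonneg hp hb0]
      have hbern := rpow_one_add_le_one_add_mul_self (s := b / a - 1)
        (by have := div_nonneg hb0 ha.le; linarith) (p := p - 1) (by linarith) (by linarith)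
      rw [add_sub_cancel, Real.div_rpow hb0 ha.le, div_le_iff₀ (by positivity)] at hbern
      have e : a ^ (p - 1) = a ^ (p - 2) * a := by
        rw [← Real.rpow_add_one ha.ne']; congr 1; ring
      rw [e] at hbern
      have e2 : (1 + (p - 1) * (b / a - 1)) * (a ^ (p - 2) * a)
          = a ^ (p - 2) * (a + (p - 1) * (b - a)) := by
        field_simp
      rw [e2] at hbern
      nlinarith
    · rcases hb0.eq_or_lt with rfl | hb0
      · rw [hpa]; simp [oddPow]; nlinarith [mul_pos hA ha]
      have hle : a ^ (p - 2) ≤ |b| ^ (p - 2) :=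
        Real.rpow_le_rpow_of_nonpos (abs_pos.2 hb0.ne) hb (by linarith)
      rw [hpa, oddPow]
      nlinarith [mul_le_mul_of_nonneg_right hle (neg_nonneg.2 hb0.le), mul_nonneg hab hA.le]

/-- Quantitative monotonicity of the odd power, uniform in the scale. -/
lemma oddPow_sub_mul_sub_ge {p a b : ℝ} (hp : 1 < p) (hb : |b| ≤ |a|) :
    min (p - 1) (1 / 2) * (a - b) ^ 2 * |a| ^ (p - 2) ≤ (a - b) * (oddPow p a - oddPow p b) := by
  rcases lt_trichotomy a 0 with ha | rfl | ha
  · have := oddPow_sub_ge hp (neg_pos.2 ha) (b := -b) (by rwa [abs_neg, ← abs_of_neg ha])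
    rw [oddPow_neg, oddPow_neg] at this
    have h0 : 0 ≤ -a - -b := by rw [abs_of_neg ha] at hb; linarith [neg_abs_le b]
    rw [abs_of_neg ha]
    nlinarith
  · have : b = 0 := by simpa using hb
    simp [this]
  · rw [abs_of_pos ha] at hb ⊢
    have := oddPow_sub_ge hp ha hb
    have h0 : 0 ≤ a - b := by linarith [le_abs_self b]
    nlinarith

lemma oddPow_sub_mul_sub_ge_max {p : ℝ} (hp : 1 < p) (a b : ℝ) :
    min (p - 1) (1 / 2) * (a - b) ^ 2 * max |a| |b| ^ (p - 2)
      ≤ (a - b) * (oddPow p a - oddPow p b) := by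
  rcases le_total |b| |a| with h | h
  · rw [max_eq_left h]; exact oddPow_sub_mul_sub_ge hp h
  · rw [max_eq_right h]; have := oddPow_sub_mul_sub_ge hp h; nlinarith

lemma oddPow_sub_mul_sub_nonneg {p : ℝ} (hp : 1 < p) (a b : ℝ) :
    0 ≤ (a - b) * (oddPow p a - oddPow p b) := by
  refine le_trans ?_ (oddPow_sub_mul_sub_ge_max hp a b)
  have : 0 < min (p - 1) (1 / 2) := lt_min (by linarith) (by norm_num)
  positivity

lemma oddPow_strictMono {p : ℝ} (hp : 1 < p) : StrictMono (oddPow p) := by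
  intro a b hab
  have h := oddPow_sub_mul_sub_ge_max hp b a
  have : 0 < min (p - 1) (1 / 2) := lt_min (by linarith) (by norm_num)
  have h3 : 0 < max |b| |a| := by
    by_contra! h
    have h1 := abs_nonpos_iff.1 ((le_max_left _ _).trans h)
    have h2 := abs_nonpos_iff.1 ((le_max_right _ _).trans h)
    linarith
  have h4 : 0 < b - a := sub_pos.2 hab
  have : 0 < min (p - 1) (1 / 2) * (b - a) ^ 2 * max |b| |a| ^ (p - 2) := by positivity
  have := this.trans_le h
  exact sub_pos.1 (pos_of_mul_pos_right this h4.le)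

/-- Two-sided bounds for the increments of the odd power on an interval avoiding the origin. -/
lemma oddPow_sub_mul_sub_mem {p m m' a b : ℝ} {U : Set ℝ} (hU : U.OrdConnected) (hp : 1 < p)
    (h0 : ∀ x ∈ U, x ≠ 0) (hm : ∀ x ∈ U, |x| ^ (p - 2) ∈ Set.Icc m m') (ha : a ∈ U) (hb : b ∈ U) :
    (p - 1) * m * (a - b) ^ 2 ≤ (a - b) * (oddPow p a - oddPow p b) ∧
      (a - b) * (oddPow p a - oddPow p b) ≤ (p - 1) * m' * (a - b) ^ 2 := by
  wlog hab : a < b generalizing a b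
  · rcases (not_lt.1 hab).eq_or_lt with h | h
    · simp [h]
    · have := this hb ha h
      constructor <;> nlinarith
  obtain ⟨c, hc, hc'⟩ := exists_hasDerivAt_eq_slope (oddPow p) (fun x => (p - 1) * |x| ^ (p - 2)) hab
    (fun x hx => (hasDerivAt_oddPow (h0 x (hU.out ha hb hx))).continuousAt.continuousWithinAt)
    (fun x hx => hasDerivAt_oddPow (h0 x (hU.out ha hb ⟨hx.1.le, hx.2.le⟩)))
  have hcU := hm c (hU.out ha hb ⟨hc.1.le, hc.2.le⟩)
  rw [eq_div_iff (sub_pos.2 hab).ne'] at hc'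
  have e : (a - b) * (oddPow p a - oddPow p b) = (p - 1) * |c| ^ (p - 2) * (a - b) ^ 2 := by
    linear_combination (a - b) * hc'
  have hp' : 0 ≤ (p - 1) * (a - b) ^ 2 := mul_nonneg (by linarith) (sq_nonneg _)
  rw [e]
  constructor <;> nlinarith [hcU.1, hcU.2]

/-! ### Change of variables in one dimension -/

lemma lintegral_comp_affine {a : ℝ} (ha : 0 < a) (b : ℝ) (f : ℝ → ENNReal) :
    ∫⁻ x, f x = ENNReal.ofReal a * ∫⁻ x, f (a * x + b) := by
  have h := lintegral_image_eq_lintegral_abs_deriv_mul (s := Set.univ) (f := fun x => a * x + b)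
    (f' := fun _ => a) MeasurableSet.univ
    (fun x _ => (by simpa using ((hasDerivAt_id x).const_mul a).add_const b :
      HasDerivAt (fun x => a * x + b) a x).hasDerivWithinAt)
    (fun x _ y _ h => by simpa [ha.ne'] using h) f
  have hs : (fun x => a * x + b) '' Set.univ = Set.univ := by
    rw [Set.image_univ]
    exact Set.range_eq_univ.2 fun y => ⟨(y - b) / a, by field_simp; ring⟩
  rw [hs] at h
  simp only [Measure.restrict_univ] at h
  rw [h, abs_of_pos ha, lintegral_const_mul' _ _ ENNReal.ofReal_ne_top]

lemma setLIntegral_deriv_mul_comp_le {s : Set ℝ} (hs : MeasurableSet s) {h h' : ℝ → ℝ}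
    (hd : ∀ x ∈ s, HasDerivAt h (h' x) x) (hinj : Set.InjOn h s) (f : ℝ → ENNReal) :
    ∫⁻ x in s, ENNReal.ofReal |h' x| * f (h x) ≤ ∫⁻ t, f t := by
  rw [← lintegral_image_eq_lintegral_abs_deriv_mul hs
    (fun x hx => (hd x hx).hasDerivWithinAt) hinj f]
  exact setLIntegral_le_lintegral _ _

/-! ### Cylindrical coordinates around the diagonal -/

/-- The first coordinate of the unit vector at angle `θ` in the plane `u₁ + u₂ + u₃ = 0`, with
respect to the orthonormal basis `(2, -1, -1) / √6`, `(0, 1, -1) / √2`. -/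
noncomputable def planeUnit₁ (θ : ℝ) : ℝ := 2 / √6 * Real.cos θ

/-- The second coordinate of the unit vector at angle `θ` in the plane `u₁ + u₂ + u₃ = 0`. -/
noncomputable def planeUnit₂ (θ : ℝ) : ℝ := 1 / √2 * Real.sin θ - 1 / √6 * Real.cos θ

/-- The third coordinate of the unit vector at angle `θ` in the plane `u₁ + u₂ + u₃ = 0`. -/
noncomputable def planeUnit₃ (θ : ℝ) : ℝ := -(1 / √2 * Real.sin θ) - 1 / √6 * Real.cos θ

lemma planeUnit_sum (θ : ℝ) : planeUnit₁ θ + planeUnit₂ θ + planeUnit₃ θ = 0 := by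
  unfold planeUnit₁ planeUnit₂ planeUnit₃; ring

lemma planeUnit_sq_sum (θ : ℝ) :
    planeUnit₁ θ ^ 2 + planeUnit₂ θ ^ 2 + planeUnit₃ θ ^ 2 = 1 := by
  have h6 : (1 / √6) ^ 2 = 1 / 6 := by rw [div_pow, Real.sq_sqrt (by norm_num)]; norm_num
  have h2 : (1 / √2) ^ 2 = 1 / 2 := by rw [div_pow, Real.sq_sqrt (by norm_num)]; norm_num
  have e : (2 : ℝ) / √6 = 2 * (1 / √6) := by ring
  unfold planeUnit₁ planeUnit₂ planeUnit₃
  rw [e]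
  linear_combination (6 * Real.cos θ ^ 2) * h6 + 2 * Real.sin θ ^ 2 * h2
    + Real.sin_sq_add_cos_sq θ

lemma planeUnit₂_sub_planeUnit₃_sq (θ : ℝ) :
    (planeUnit₂ θ - planeUnit₃ θ) ^ 2 = 2 * Real.sin θ ^ 2 := by
  have h2 : (1 / √2) ^ 2 = 1 / 2 := by rw [div_pow, Real.sq_sqrt (by norm_num)]; norm_num
  unfold planeUnit₂ planeUnit₃
  linear_combination (4 * Real.sin θ ^ 2) * h2

/-- The point with cylindrical coordinates `(ξ, θ, r)`: its coordinates add up to `ξ`, and it lies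
at distance `r` from the diagonal of `ℝ³`, in the direction `θ`. -/
noncomputable def cylPoint (ξ θ r : ℝ) : ℝ × ℝ × ℝ :=
  (ξ / 3 + r * planeUnit₁ θ, ξ / 3 + r * planeUnit₂ θ, ξ / 3 + r * planeUnit₃ θ)

lemma lintegral_triple {F : ℝ × ℝ × ℝ → ENNReal} (hF : Measurable F) :
    ∫⁻ y, F y = ∫⁻ a, ∫⁻ b, ∫⁻ c, F (a, b, c) := by
  rw [Measure.volume_eq_prod, lintegral_prod _ hF.aemeasurable]
  refine lintegral_congr fun a => ?_
  rw [Measure.volume_eq_prod, lintegral_prod _ (by fun_prop)]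

/-- Integration in cylindrical coordinates around the diagonal. -/
lemma lintegral_cylPoint {F : ℝ × ℝ × ℝ → ENNReal} (hF : Measurable F) :
    ∫⁻ y, F y = ENNReal.ofReal (1 / √3) * ∫⁻ ξ, ∫⁻ θ in Set.Ioo (-Real.pi) Real.pi,
      ∫⁻ r in Set.Ioi 0, ENNReal.ofReal r * F (cylPoint ξ θ r) := by
  have h1 : ∫⁻ y, F y = ∫⁻ ξ, ∫⁻ a, ∫⁻ b, F (a, b, ξ - a - b) := by
    rw [lintegral_triple hF]
    have : ∀ a b : ℝ, ∫⁻ c, F (a, b, c) = ∫⁻ ξ, F (a, b, ξ - a - b) := by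
      intro a b
      rw [← lintegral_sub_right_eq_self _ (a + b)]
      simp only [sub_add_eq_sub_sub]
    simp_rw [this]
    have h2 : ∀ a : ℝ, ∫⁻ b, ∫⁻ ξ, F (a, b, ξ - a - b) = ∫⁻ ξ, ∫⁻ b, F (a, b, ξ - a - b) :=
      fun a => lintegral_lintegral_swap (by fun_prop)
    simp_rw [h2]
    exact lintegral_lintegral_swap (by fun_prop)
  rw [h1, ← lintegral_const_mul' _ _ ENNReal.ofReal_ne_top]
  refine lintegral_congr fun ξ => ?_
  have h2 : ∀ a : ℝ, ∫⁻ b, F (a, b, ξ - a - b) = ENNReal.ofReal (1 / √2) * ∫⁻ z,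
      F (a, 1 / √2 * z + (ξ / 3 - (a - ξ / 3) / 2), ξ - a -
        (1 / √2 * z + (ξ / 3 - (a - ξ / 3) / 2))) := fun a =>
    lintegral_comp_affine (by positivity) _ _
  simp_rw [h2]
  rw [lintegral_const_mul' _ _ ENNReal.ofReal_ne_top,
    lintegral_comp_affine (a := 2 / √6) (by positivity) (ξ / 3), ← mul_assoc,
    ← ENNReal.ofReal_mul (by positivity)]
  congr 1
  · congr 1
    have : √6 = √2 * √3 := by rw [← Real.sqrt_mul (by norm_num)]; norm_num
    rw [this]
    have h2 : √2 * √2 = 2 := Real.mul_self_sqrt (by norm_num)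
    field_simp
    nlinarith
  · have e : ∀ x z : ℝ, F (2 / √6 * x + ξ / 3, 1 / √2 * z + (ξ / 3 - (2 / √6 * x + ξ / 3 - ξ / 3) / 2),
        ξ - (2 / √6 * x + ξ / 3) - (1 / √2 * z + (ξ / 3 - (2 / √6 * x + ξ / 3 - ξ / 3) / 2)))
        = (fun q : ℝ × ℝ => F (ξ / 3 + 2 / √6 * q.1, ξ / 3 + (1 / √2 * q.2 - 1 / √6 * q.1),
          ξ / 3 + (-(1 / √2 * q.2) - 1 / √6 * q.1))) (x, z) := by
      intro x z; dsimp only; congr 2 <;> [skip; congr 1] <;> ring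
    simp_rw [e]
    rw [← lintegral_prod (fun q : ℝ × ℝ => F (ξ / 3 + 2 / √6 * q.1,
      ξ / 3 + (1 / √2 * q.2 - 1 / √6 * q.1), ξ / 3 + (-(1 / √2 * q.2) - 1 / √6 * q.1)))
      (by fun_prop), ← Measure.volume_eq_prod, ← lintegral_comp_polarCoord_symm,
      polarCoord_target, Measure.volume_eq_prod, ← Measure.prod_restrict,
      lintegral_prod_symm]
    · refine lintegral_congr fun θ => lintegral_congr fun r => ?_
      simp only [polarCoord_symm_apply, smul_eq_mul, cylPoint, planeUnit₁, planeUnit₂, planeUnit₃]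
      congr 3 <;> [skip; congr 1] <;> ring
    · simp only [polarCoord_symm_apply]
      exact Measurable.aemeasurable (by fun_prop)

/-! ### Sums of three points of the curve -/

/-- The sum of the three points of the curve `s = |y|^p` lying over the coordinates of `y`. -/
noncomputable def curveSum (p : ℝ) (y : ℝ × ℝ × ℝ) : ℝ × ℝ :=
  (y.1 + y.2.1 + y.2.2, |y.1| ^ p + |y.2.1| ^ p + |y.2.2| ^ p)

/-- The density of the product of three copies of the weighted arclength of the curve. -/
noncomputable def tripleWeight (p : ℝ) (y : ℝ × ℝ × ℝ) : ℝ :=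
  |y.1| ^ ((p - 2) / 6) * |y.2.1| ^ ((p - 2) / 6) * |y.2.2| ^ ((p - 2) / 6)

/-- The sum of the squared differences of the coordinates: three times the squared distance to the
diagonal. -/
def sqGap (y : ℝ × ℝ × ℝ) : ℝ :=
  (y.1 - y.2.1) ^ 2 + (y.1 - y.2.2) ^ 2 + (y.2.1 - y.2.2) ^ 2

/-- The sum over pairs of coordinates of the difference times the difference of the odd powers. Up
to a factor it is the radial derivative of `y ↦ ∑ |yᵢ|^p` away from the diagonal. -/
noncomputable def powGap (p : ℝ) (y : ℝ × ℝ × ℝ) : ℝ :=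
  (y.1 - y.2.1) * (oddPow p y.1 - oddPow p y.2.1) + (y.1 - y.2.2) * (oddPow p y.1 - oddPow p y.2.2)
    + (y.2.1 - y.2.2) * (oddPow p y.2.1 - oddPow p y.2.2)

/-- The largest absolute value of a coordinate. -/
noncomputable def maxAbs (y : ℝ × ℝ × ℝ) : ℝ := max |y.1| (max |y.2.1| |y.2.2|)

@[fun_prop]
lemma measurable_curveSum (p : ℝ) : Measurable (curveSum p) := by unfold curveSum; fun_prop

@[fun_prop]
lemma measurable_tripleWeight (p : ℝ) : Measurable (tripleWeight p) := by
  unfold tripleWeight; fun_prop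

lemma tripleWeight_nonneg (p : ℝ) (y : ℝ × ℝ × ℝ) : 0 ≤ tripleWeight p y := by
  unfold tripleWeight; positivity

lemma min_sub_one_half_pos {p : ℝ} (hp : 1 < p) : 0 < min (p - 1) (1 / 2) :=
  lt_min (by linarith) (by norm_num)

lemma sqGap_nonneg (y : ℝ × ℝ × ℝ) : 0 ≤ sqGap y := by unfold sqGap; positivity

lemma powGap_ge {p : ℝ} (hp : 1 < p) (y : ℝ × ℝ × ℝ) :
    min (p - 1) (1 / 2) / 3 * sqGap y * maxAbs y ^ (p - 2) ≤ powGap p y := by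
  obtain ⟨a, b, c⟩ := y
  -- Only the two pairs that contain the coordinate of largest absolute value are used.
  have key : ∀ a b c : ℝ, |b| ≤ |a| → |c| ≤ |a| →
      min (p - 1) (1 / 2) / 3 * ((a - b) ^ 2 + (a - c) ^ 2 + (b - c) ^ 2) * |a| ^ (p - 2) ≤
      (a - b) * (oddPow p a - oddPow p b) + (a - c) * (oddPow p a - oddPow p c)
        + (b - c) * (oddPow p b - oddPow p c) := by
    intro a b c hb hc
    have h1 := oddPow_sub_mul_sub_ge hp hb
    have h2 := oddPow_sub_mul_sub_ge hp hc
    have h3 := oddPow_sub_mul_sub_nonneg hp b c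
    have h4 : 0 ≤ min (p - 1) (1 / 2) * |a| ^ (p - 2) :=
      mul_nonneg (min_sub_one_half_pos hp).le (by positivity)
    have h5 : (a - b) ^ 2 + (a - c) ^ 2 + (b - c) ^ 2 ≤ 3 * ((a - b) ^ 2 + (a - c) ^ 2) := by
      nlinarith [sq_nonneg (a - b + (a - c))]
    have := mul_le_mul_of_nonneg_left h5 h4
    linarith
  simp only [sqGap, powGap, maxAbs]
  rcases le_total |b| |a| with hab | hab <;> rcases le_total |c| |a| with hac | hac <;>
    rcases le_total |c| |b| with hbc | hbc
  · rw [max_eq_left hbc, max_eq_left hab]; exact key a b c hab hac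
  · rw [max_eq_right hbc, max_eq_left hac]; exact key a b c hab hac
  · rw [max_eq_left hbc, max_eq_left hab]; exact key a b c hab (hbc.trans hab)
  · rw [max_eq_right hbc, max_eq_right hac]; linarith [key c a b hac hbc]
  · rw [max_eq_left hbc, max_eq_right hab]; linarith [key b a c hab hbc]
  · rw [max_eq_right hbc, max_eq_left hac]; exact key a b c (hbc.trans hac) hac
  · rw [max_eq_left hbc, max_eq_right hab]; linarith [key b a c hab hbc]
  · rw [max_eq_right hbc, max_eq_right hac]; linarith [key c a b hac hbc]

lemma curveSum_cylPoint_fst (p ξ θ r : ℝ) : (curveSum p (cylPoint ξ θ r)).1 = ξ := by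
  simp only [curveSum, cylPoint]
  linear_combination r * planeUnit_sum θ

lemma sqGap_cylPoint (ξ θ r : ℝ) : sqGap (cylPoint ξ θ r) = 3 * r ^ 2 := by
  simp only [sqGap, cylPoint]
  linear_combination 3 * r ^ 2 * planeUnit_sq_sum θ
    - r ^ 2 * (planeUnit₁ θ + planeUnit₂ θ + planeUnit₃ θ) * planeUnit_sum θ

/-- The height `∑ |yᵢ|^p` along a ray issuing orthogonally from the diagonal. -/
noncomputable def rayHeight (p ξ θ r : ℝ) : ℝ := (curveSum p (cylPoint ξ θ r)).2

/-- The derivative of `rayHeight` in the radial variable. -/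
noncomputable def rayHeightDeriv (p ξ θ r : ℝ) : ℝ :=
  p * oddPow p (cylPoint ξ θ r).1 * planeUnit₁ θ + p * oddPow p (cylPoint ξ θ r).2.1 * planeUnit₂ θ
    + p * oddPow p (cylPoint ξ θ r).2.2 * planeUnit₃ θ

lemma curveSum_cylPoint (p ξ θ r : ℝ) : curveSum p (cylPoint ξ θ r) = (ξ, rayHeight p ξ θ r) :=
  Prod.ext (curveSum_cylPoint_fst p ξ θ r) rfl

lemma hasDerivAt_rayHeight {p : ℝ} (hp : 1 < p) (ξ θ r : ℝ) :
    HasDerivAt (rayHeight p ξ θ) (rayHeightDeriv p ξ θ r) r := by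
  have h : ∀ u : ℝ, HasDerivAt (fun r => |ξ / 3 + r * u| ^ p) (p * oddPow p (ξ / 3 + r * u) * u) r := by
    intro u
    have h1 : HasDerivAt (fun r => ξ / 3 + r * u) u r := by
      simpa using ((hasDerivAt_id r).mul_const u).const_add (ξ / 3)
    exact (hasDerivAt_abs_rpow_oddPow hp (ξ / 3 + r * u)).comp r h1
  exact ((h _).add (h _)).add (h _)

lemma mul_rayHeightDeriv (p ξ θ r : ℝ) :
    3 * r * rayHeightDeriv p ξ θ r = p * powGap p (cylPoint ξ θ r) := by
  simp only [rayHeightDeriv, powGap]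
  set A := oddPow p (cylPoint ξ θ r).1
  set B := oddPow p (cylPoint ξ θ r).2.1
  set C := oddPow p (cylPoint ξ θ r).2.2
  simp only [cylPoint]
  linear_combination p * r * (A + B + C) * planeUnit_sum θ

lemma powGap_nonneg {p : ℝ} (hp : 1 < p) (y : ℝ × ℝ × ℝ) : 0 ≤ powGap p y :=
  add_nonneg (add_nonneg (oddPow_sub_mul_sub_nonneg hp _ _) (oddPow_sub_mul_sub_nonneg hp _ _))
    (oddPow_sub_mul_sub_nonneg hp _ _)

lemma maxAbs_pos_of_sqGap_pos {y : ℝ × ℝ × ℝ} (h : 0 < sqGap y) : 0 < maxAbs y := by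
  by_contra! h0
  have h1 : y.1 = 0 := abs_nonpos_iff.1 ((le_max_left _ _).trans h0)
  have h2 : y.2.1 = 0 := abs_nonpos_iff.1 (((le_max_left _ _).trans (le_max_right _ _)).trans h0)
  have h3 : y.2.2 = 0 := abs_nonpos_iff.1 (((le_max_right _ _).trans (le_max_right _ _)).trans h0)
  simp [sqGap, h1, h2, h3] at h

lemma rayHeightDeriv_pos {p : ℝ} (hp : 1 < p) (ξ θ : ℝ) {r : ℝ} (hr : 0 < r) :
    0 < rayHeightDeriv p ξ θ r := by
  have h1 : 0 < sqGap (cylPoint ξ θ r) := by rw [sqGap_cylPoint]; positivity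
  have h2 := maxAbs_pos_of_sqGap_pos h1
  have h3 := min_sub_one_half_pos hp
  have h4 : 0 < powGap p (cylPoint ξ θ r) := lt_of_lt_of_le (by positivity) (powGap_ge hp _)
  have h5 := mul_rayHeightDeriv p ξ θ r
  have h6 : 0 < 3 * r * rayHeightDeriv p ξ θ r := by rw [h5]; exact mul_pos (by linarith) h4
  exact pos_of_mul_pos_right h6 (by positivity)

lemma rayHeight_strictMonoOn {p : ℝ} (hp : 1 < p) (ξ θ : ℝ) :
    StrictMonoOn (rayHeight p ξ θ) (Set.Ici 0) := by
  refine strictMonoOn_of_deriv_pos (convex_Ici 0)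
    (fun r _ => (hasDerivAt_rayHeight hp ξ θ r).continuousAt.continuousWithinAt) fun r hr => ?_
  rw [interior_Ici] at hr
  rw [(hasDerivAt_rayHeight hp ξ θ r).deriv]
  exact rayHeightDeriv_pos hp ξ θ hr

lemma measurable_rayHeight {p : ℝ} (ξ θ : ℝ) : Measurable (rayHeight p ξ θ) := by
  unfold rayHeight curveSum cylPoint; fun_prop

/-- If the squared weight on `R` is dominated by the radial derivative times a function of the
angle, then the weighted triple sum of the curve, restricted to `R`, has a bounded density. -/
lemma setLIntegral_curveSum_le_of_angle {p : ℝ} (hp : 1 < p) {R : Set (ℝ × ℝ × ℝ)}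
    (hR : MeasurableSet R) {k : ℝ → ENNReal} (hk : Measurable k)
    (H : ∀ ξ θ r, 0 < r → cylPoint ξ θ r ∈ R →
      ENNReal.ofReal (tripleWeight p (cylPoint ξ θ r) ^ 2 * sqGap (cylPoint ξ θ r)) ≤
        k θ * ENNReal.ofReal (p * powGap p (cylPoint ξ θ r)))
    {Ψ : ℝ × ℝ → ENNReal} (hΨ : Measurable Ψ) :
    ∫⁻ y in R, ENNReal.ofReal (tripleWeight p y ^ 2) * Ψ (curveSum p y) ≤
      ENNReal.ofReal (1 / √3) * (∫⁻ θ in Set.Ioo (-Real.pi) Real.pi, k θ) * ∫⁻ x, Ψ x := by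
  rw [← lintegral_indicator hR, lintegral_cylPoint ((Measurable.indicator (by fun_prop) hR)),
    mul_assoc]
  gcongr
  have hin : ∀ ξ θ : ℝ, ∫⁻ r in Set.Ioi 0, ENNReal.ofReal r *
      R.indicator (fun y => ENNReal.ofReal (tripleWeight p y ^ 2) * Ψ (curveSum p y))
        (cylPoint ξ θ r) ≤ k θ * ∫⁻ t, Ψ (ξ, t) := by
    intro ξ θ
    calc _ ≤ ∫⁻ r in Set.Ioi 0, k θ *
          (ENNReal.ofReal |rayHeightDeriv p ξ θ r| * Ψ (ξ, rayHeight p ξ θ r)) := by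
          refine setLIntegral_mono' measurableSet_Ioi fun r hr => ?_
          by_cases hy : cylPoint ξ θ r ∈ R
          · have hr : 0 < r := hr
            have h1 := H ξ θ r hr hy
            rw [sqGap_cylPoint, ← mul_rayHeightDeriv,
              show tripleWeight p (cylPoint ξ θ r) ^ 2 * (3 * r ^ 2)
                = 3 * r * (r * tripleWeight p (cylPoint ξ θ r) ^ 2) by ring,
              ENNReal.ofReal_mul (p := 3 * r) (by positivity),
              ENNReal.ofReal_mul (p := 3 * r) (by positivity), mul_left_comm,
              ENNReal.mul_le_mul_iff_right (by positivity) ENNReal.ofReal_ne_top,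
              ENNReal.ofReal_mul hr.le] at h1
            rw [Set.indicator_of_mem hy, curveSum_cylPoint, ← mul_assoc, ← mul_assoc,
              abs_of_pos (rayHeightDeriv_pos hp ξ θ hr)]
            gcongr
          · simp [hy]
      _ = k θ * ∫⁻ r in Set.Ioi 0,
          (ENNReal.ofReal |rayHeightDeriv p ξ θ r| * Ψ (ξ, rayHeight p ξ θ r)) := by
          rw [lintegral_const_mul]
          have : Measurable (rayHeightDeriv p ξ θ) := by
            unfold rayHeightDeriv oddPow cylPoint; fun_prop
          have := measurable_rayHeight (p := p) ξ θ
          fun_prop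
      _ ≤ _ := by
          exact mul_le_mul' le_rfl (setLIntegral_deriv_mul_comp_le measurableSet_Ioi
            (fun r _ => hasDerivAt_rayHeight hp ξ θ r)
            ((rayHeight_strictMonoOn hp ξ θ).injOn.mono Set.Ioi_subset_Ici_self)
            (fun t => Ψ (ξ, t)))
  calc _ ≤ ∫⁻ ξ, ∫⁻ θ in Set.Ioo (-Real.pi) Real.pi, k θ * ∫⁻ t, Ψ (ξ, t) :=
        lintegral_mono fun ξ => lintegral_mono fun θ => hin ξ θ
    _ = _ := by
        simp_rw [lintegral_mul_const _ hk]
        rw [lintegral_const_mul _ (by fun_prop), Measure.volume_eq_prod,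
          lintegral_prod _ hΨ.aemeasurable]

/-- A lower counterpart of `setLIntegral_curveSum_le_of_angle`: over the region between the lower
edge `t = 3 |ξ/3|^p` of the range of `curveSum` and its translate by `t₀`, the density is bounded
below if the squared weight dominates the radial derivative up to radius `r₀`, and the rays of
length `r₀` climb at least by `t₀`. -/
lemma setLIntegral_curveSum_ge {p : ℝ} (hp : 1 < p) {R : Set (ℝ × ℝ × ℝ)} (hR : MeasurableSet R)
    {V : Set ℝ} (hV : MeasurableSet V) {r₀ t₀ : ℝ} (hr₀ : 0 < r₀) {κ : ℝ} (hκ : 0 ≤ κ)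
    (hRm : ∀ ξ ∈ V, ∀ θ, ∀ r ∈ Set.Ioo 0 r₀, cylPoint ξ θ r ∈ R)
    (H : ∀ y ∈ R, κ * (p * powGap p y) ≤ tripleWeight p y ^ 2 * sqGap y)
    (hclimb : ∀ ξ ∈ V, ∀ θ, 3 * |ξ / 3| ^ p + t₀ ≤ rayHeight p ξ θ r₀)
    {Ψ : ℝ × ℝ → ENNReal} (hΨ : Measurable Ψ) :
    ENNReal.ofReal (κ * (2 * Real.pi / √3)) *
        ∫⁻ x in {x : ℝ × ℝ | x.1 ∈ V ∧ 3 * |x.1 / 3| ^ p ≤ x.2 ∧ x.2 < 3 * |x.1 / 3| ^ p + t₀}, Ψ x ≤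
      ∫⁻ y in R, ENNReal.ofReal (tripleWeight p y ^ 2) * Ψ (curveSum p y) := by
  set S : Set (ℝ × ℝ) :=
    {x | x.1 ∈ V ∧ 3 * |x.1 / 3| ^ p ≤ x.2 ∧ x.2 < 3 * |x.1 / 3| ^ p + t₀} with hS
  have hSm : MeasurableSet S :=
    (hV.preimage measurable_fst).inter
      ((measurableSet_le (by fun_prop) measurable_snd).inter
        (measurableSet_lt measurable_snd (by fun_prop)))
  rw [← lintegral_indicator hR, lintegral_cylPoint ((Measurable.indicator (by fun_prop) hR)),
    ← lintegral_indicator hSm, Measure.volume_eq_prod,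
    lintegral_prod _ (hΨ.indicator hSm).aemeasurable]
  have hin : ∀ ξ θ : ℝ, ENNReal.ofReal κ * ∫⁻ t, S.indicator Ψ (ξ, t) ≤
      ∫⁻ r in Set.Ioi 0, ENNReal.ofReal r *
      R.indicator (fun y => ENNReal.ofReal (tripleWeight p y ^ 2) * Ψ (curveSum p y))
        (cylPoint ξ θ r) := by
    intro ξ θ
    by_cases hξ : ξ ∈ V
    swap
    · simp [S, hξ]
    have h0 : rayHeight p ξ θ 0 = 3 * |ξ / 3| ^ p := by
      simp only [rayHeight, curveSum, cylPoint]; ring_nf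
    have hcont : ContinuousOn (rayHeight p ξ θ) (Set.Icc 0 r₀) := fun r _ =>
      (hasDerivAt_rayHeight hp ξ θ r).continuousAt.continuousWithinAt
    have himg : Set.Ioo (3 * |ξ / 3| ^ p) (3 * |ξ / 3| ^ p + t₀) ⊆
        rayHeight p ξ θ '' Set.Ioo 0 r₀ := by
      refine Set.Subset.trans ?_ (intermediate_value_Ioo hr₀.le hcont)
      rw [h0]
      exact Set.Ioo_subset_Ioo_right (hclimb ξ hξ θ)
    calc ENNReal.ofReal κ * ∫⁻ t, S.indicator Ψ (ξ, t)
        = ENNReal.ofReal κ * ∫⁻ t in Set.Ioo (3 * |ξ / 3| ^ p) (3 * |ξ / 3| ^ p + t₀), Ψ (ξ, t) := by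
          congr 1
          rw [setLIntegral_congr Ioo_ae_eq_Ico, ← lintegral_indicator measurableSet_Ico]
          refine lintegral_congr fun t => ?_
          simp [Set.indicator, S, hξ]
      _ ≤ ENNReal.ofReal κ * ∫⁻ t in rayHeight p ξ θ '' Set.Ioo 0 r₀, Ψ (ξ, t) := by
          gcongr
      _ = ∫⁻ r in Set.Ioo 0 r₀, ENNReal.ofReal κ *
          (ENNReal.ofReal |rayHeightDeriv p ξ θ r| * Ψ (ξ, rayHeight p ξ θ r)) := by
          rw [lintegral_image_eq_lintegral_abs_deriv_mul measurableSet_Ioo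
            (fun r _ => (hasDerivAt_rayHeight hp ξ θ r).hasDerivWithinAt)
            ((rayHeight_strictMonoOn hp ξ θ).injOn.mono
              (Set.Ioo_subset_Icc_self.trans Set.Icc_subset_Ici_self)),
            lintegral_const_mul' _ _ ENNReal.ofReal_ne_top]
      _ ≤ ∫⁻ r in Set.Ioo 0 r₀, ENNReal.ofReal r *
          R.indicator (fun y => ENNReal.ofReal (tripleWeight p y ^ 2) * Ψ (curveSum p y))
            (cylPoint ξ θ r) := by
          refine setLIntegral_mono' measurableSet_Ioo fun r hr => ?_
          have hy := hRm ξ hξ θ r hr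
          have h1 := H _ hy
          have hr0 : 0 < r := hr.1
          rw [sqGap_cylPoint, ← mul_rayHeightDeriv] at h1
          have h2 : κ * rayHeightDeriv p ξ θ r ≤ r * tripleWeight p (cylPoint ξ θ r) ^ 2 := by
            have h3 : 0 < 3 * r := by positivity
            nlinarith
          rw [Set.indicator_of_mem hy, curveSum_cylPoint, ← mul_assoc, ← mul_assoc,
            abs_of_pos (rayHeightDeriv_pos hp ξ θ hr0), ← ENNReal.ofReal_mul hκ,
            ← ENNReal.ofReal_mul hr0.le]
          gcongr
      _ ≤ _ := lintegral_mono_set Set.Ioo_subset_Ioi_self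
  have hconst : ENNReal.ofReal (κ * (2 * Real.pi / √3)) = ENNReal.ofReal (1 / √3) *
      (ENNReal.ofReal (2 * Real.pi) * ENNReal.ofReal κ) := by
    rw [← ENNReal.ofReal_mul (by positivity), ← ENNReal.ofReal_mul (by positivity)]
    congr 1; ring
  rw [hconst, mul_assoc]
  gcongr
  calc _ = ∫⁻ ξ, ∫⁻ θ in Set.Ioo (-Real.pi) Real.pi,
        ENNReal.ofReal κ * ∫⁻ t, S.indicator Ψ (ξ, t) := by
        simp_rw [lintegral_const, Measure.restrict_apply_univ, Real.volume_Ioo,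
          show Real.pi - -Real.pi = 2 * Real.pi by ring]
        rw [← lintegral_const_mul' _ _ (ENNReal.mul_ne_top ENNReal.ofReal_ne_top
          ENNReal.ofReal_ne_top)]
        refine lintegral_congr fun ξ => ?_
        ring
    _ ≤ _ := lintegral_mono fun ξ => lintegral_mono fun θ => hin ξ θ

/-- If the squared weight on `R` is dominated by the Jacobian of `y ↦ (∑ yᵢ, ∑ |yᵢ|^p)` in the last
two coordinates, times a function of the first coordinate and of the height whose integral in the
first coordinate is bounded, then the weighted triple sum of the curve, restricted to `R`, has a
bounded density. -/
lemma setLIntegral_curveSum_le_of_coord {p : ℝ} (hp : 1 < p) {R : Set (ℝ × ℝ × ℝ)}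
    (hR : MeasurableSet R) {k : ℝ → ℝ → ENNReal} (hk : Measurable (Function.uncurry k))
    (H : ∀ y ∈ R, ENNReal.ofReal (tripleWeight p y ^ 2) ≤
      k y.1 (curveSum p y).2 * ENNReal.ofReal (p * |oddPow p y.2.2 - oddPow p y.2.1|))
    {C : ENNReal} (hC : ∀ t, ∫⁻ x, k x t ≤ C) {Ψ : ℝ × ℝ → ENNReal} (hΨ : Measurable Ψ) :
    ∫⁻ y in R, ENNReal.ofReal (tripleWeight p y ^ 2) * Ψ (curveSum p y) ≤ 2 * C * ∫⁻ x, Ψ x := by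
  set F : ℝ × ℝ × ℝ → ENNReal := R.indicator fun y =>
    ENNReal.ofReal (tripleWeight p y ^ 2) * Ψ (curveSum p y) with hF
  have hFm : Measurable F := Measurable.indicator (by fun_prop) hR
  have hk' : ∀ x : ℝ, Measurable (k x) := fun x => hk.of_uncurry_left
  -- For fixed first coordinate and fixed sum, the last coordinate is traded for the height.
  have hin : ∀ x ξ : ℝ, ∫⁻ c, F (x, ξ - x - c, c) ≤ 2 * ∫⁻ t, k x t * Ψ (ξ, t) := by
    intro x ξ
    set h : ℝ → ℝ := fun c => |x| ^ p + |ξ - x - c| ^ p + |c| ^ p with hh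
    set h' : ℝ → ℝ := fun c => p * (oddPow p c - oddPow p (ξ - x - c)) with hh'
    have hd : ∀ c, HasDerivAt h (h' c) c := by
      intro c
      have h1 : HasDerivAt (fun c => ξ - x - c) (-1) c := by
        simpa using (hasDerivAt_id c).const_sub (ξ - x)
      have h2 := (hasDerivAt_abs_rpow_oddPow hp (ξ - x - c)).comp c h1
      refine ((h2.const_add (|x| ^ p)).add (hasDerivAt_abs_rpow_oddPow hp c)).congr_deriv ?_
      simp only [hh']; ring
    have hmono : StrictMonoOn h (Set.Ici ((ξ - x) / 2)) := by
      refine strictMonoOn_of_deriv_pos (convex_Ici _)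
        (fun r _ => (hd r).continuousAt.continuousWithinAt) fun c hc => ?_
      rw [interior_Ici, Set.mem_Ioi] at hc
      rw [(hd c).deriv]
      exact mul_pos (by linarith) (sub_pos.2 (oddPow_strictMono hp (by linarith)))
    have hanti : StrictAntiOn h (Set.Iic ((ξ - x) / 2)) := by
      refine strictAntiOn_of_deriv_neg (convex_Iic _)
        (fun r _ => (hd r).continuousAt.continuousWithinAt) fun c hc => ?_
      rw [interior_Iic, Set.mem_Iio] at hc
      rw [(hd c).deriv]
      exact mul_neg_of_pos_of_neg (by linarith)
        (sub_neg.2 (oddPow_strictMono hp (by linarith)))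
    calc ∫⁻ c, F (x, ξ - x - c, c)
        ≤ ∫⁻ c, ENNReal.ofReal |h' c| * (k x (h c) * Ψ (ξ, h c)) := by
          refine lintegral_mono fun c => ?_
          by_cases hy : (x, ξ - x - c, c) ∈ R
          · have h1 := H _ hy
            have e : curveSum p (x, ξ - x - c, c) = (ξ, h c) := by
              simp only [curveSum, hh]; congr 1; ring
            rw [e] at h1
            simp only [hF]
            rw [Set.indicator_of_mem hy, e, ← mul_assoc, mul_comm (ENNReal.ofReal |h' c|)]
            simp only [hh', abs_mul, abs_of_pos (by linarith : 0 < p)]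
            gcongr
          · simp [hF, hy]
      _ ≤ (∫⁻ c in Set.Ici ((ξ - x) / 2), ENNReal.ofReal |h' c| * (k x (h c) * Ψ (ξ, h c))) +
          ∫⁻ c in Set.Iic ((ξ - x) / 2), ENNReal.ofReal |h' c| * (k x (h c) * Ψ (ξ, h c)) := by
          rw [← setLIntegral_univ, ← Set.Ici_union_Iic (a := (ξ - x) / 2)]
          exact lintegral_union_le _ _ _
      _ ≤ (∫⁻ t, k x t * Ψ (ξ, t)) + ∫⁻ t, k x t * Ψ (ξ, t) :=
          add_le_add
            (setLIntegral_deriv_mul_comp_le measurableSet_Ici (fun c _ => hd c) hmono.injOn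
              (fun t => k x t * Ψ (ξ, t)))
            (setLIntegral_deriv_mul_comp_le measurableSet_Iic (fun c _ => hd c) hanti.injOn
              (fun t => k x t * Ψ (ξ, t)))
      _ = _ := (two_mul _).symm
  have h1 : ∀ a : ℝ, ∫⁻ b, ∫⁻ c, F (a, b, c) = ∫⁻ ξ, ∫⁻ c, F (a, ξ - a - c, c) := by
    intro a
    rw [lintegral_lintegral_swap (by fun_prop)]
    conv_rhs => rw [lintegral_lintegral_swap (by fun_prop)]
    refine lintegral_congr fun c => ?_
    rw [← lintegral_sub_right_eq_self _ (a + c)]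
    simp only [sub_add_eq_sub_sub]
  have hkΨ : Measurable fun q : ℝ × ℝ × ℝ => k q.1 q.2.2 * Ψ (q.2.1, q.2.2) :=
    (hk.comp (measurable_fst.prodMk (measurable_snd.comp measurable_snd))).mul (by fun_prop)
  calc ∫⁻ y in R, ENNReal.ofReal (tripleWeight p y ^ 2) * Ψ (curveSum p y)
      = ∫⁻ a, ∫⁻ ξ, ∫⁻ c, F (a, ξ - a - c, c) := by
        rw [← lintegral_indicator hR, ← hF, lintegral_triple hFm]
        exact lintegral_congr h1
    _ ≤ ∫⁻ a, ∫⁻ ξ, 2 * ∫⁻ t, k a t * Ψ (ξ, t) :=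
        lintegral_mono fun a => lintegral_mono fun ξ => hin a ξ
    _ = 2 * ∫⁻ q : ℝ × ℝ × ℝ, k q.1 q.2.2 * Ψ (q.2.1, q.2.2) := by
        rw [lintegral_triple hkΨ, ← lintegral_const_mul' _ _ (by simp)]
        refine lintegral_congr fun a => ?_
        rw [← lintegral_const_mul' _ _ (by simp)]
    _ = 2 * ∫⁻ x : ℝ × ℝ, (∫⁻ a, k a x.2) * Ψ x := by
        congr 1
        rw [Measure.volume_eq_prod, lintegral_prod_symm _ hkΨ.aemeasurable]
        refine lintegral_congr fun x => ?_
        have hx : Measurable fun a => k a x.2 := hk.comp (measurable_id.prodMk measurable_const)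
        exact lintegral_mul_const (Ψ x) hx
    _ ≤ 2 * ∫⁻ x : ℝ × ℝ, C * Ψ x := by
        gcongr with x
        exact hC x.2
    _ = _ := by rw [lintegral_const_mul _ hΨ, mul_assoc]

/-! ### Boundedness of the density of the triple sum -/

lemma lintegral_abs_rpow_neg_le {a : ℝ} (ha : a < 1) {T : ℝ} (hT : 0 ≤ T) :
    ∫⁻ x in Set.Icc (-T) T, ENNReal.ofReal (|x| ^ (-a)) ≤
      ENNReal.ofReal (2 / (1 - a) * T ^ (1 - a)) := by
  have hpos : ∫⁻ x in Set.Ioc 0 T, ENNReal.ofReal (|x| ^ (-a)) =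
      ENNReal.ofReal (1 / (1 - a) * T ^ (1 - a)) := by
    have h1 : ∫⁻ x in Set.Ioc 0 T, ENNReal.ofReal (|x| ^ (-a)) =
        ∫⁻ x in Set.Ioc 0 T, ENNReal.ofReal (x ^ (-a)) :=
      setLIntegral_congr_fun measurableSet_Ioc fun x hx => by
        simp only [abs_of_pos hx.1]
    have h2 := intervalIntegral.intervalIntegrable_rpow' (a := 0) (b := T) (r := -a) (by linarith)
    rw [intervalIntegrable_iff_integrableOn_Ioc_of_le hT] at h2
    rw [h1, ← ofReal_integral_eq_lintegral_ofReal h2, ← intervalIntegral.integral_of_le hT,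
      integral_rpow (Or.inl (by linarith)), Real.zero_rpow (by linarith)]
    · congr 1; rw [show -a + 1 = 1 - a by ring]; ring
    · filter_upwards [ae_restrict_mem measurableSet_Ioc] with x hx
      exact Real.rpow_nonneg hx.1.le _
  have hneg : ∫⁻ x in Set.Ico (-T) 0, ENNReal.ofReal (|x| ^ (-a)) =
      ∫⁻ x in Set.Ioc 0 T, ENNReal.ofReal (|x| ^ (-a)) := by
    have := (Measure.measurePreserving_neg (volume : Measure ℝ)).setLIntegral_comp_preimage_emb
      (Homeomorph.neg ℝ).measurableEmbedding (fun x => ENNReal.ofReal (|x| ^ (-a))) (Set.Ioc 0 T)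
    simpa using this
  have hsub : Set.Icc (-T) T ⊆ (Set.Ico (-T) 0 ∪ Set.Ioc 0 T) ∪ {0} := by
    intro x hx
    rcases lt_trichotomy x 0 with h | h | h
    · exact Or.inl (Or.inl ⟨hx.1, h⟩)
    · exact Or.inr h
    · exact Or.inl (Or.inr ⟨h, hx.2⟩)
  refine (lintegral_mono_set hsub).trans ((lintegral_union_le _ _ _).trans ?_)
  simp only [Measure.restrict_singleton, Real.volume_singleton, zero_smul, lintegral_zero_measure,
    add_zero]
  refine (lintegral_union_le _ _ _).trans ?_
  rw [hneg, hpos, ← two_mul, ← ENNReal.ofReal_ofNat 2, ← ENNReal.ofReal_mul (by norm_num)]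
  apply le_of_eq; congr 1; ring

lemma sin_sq_ge {θ : ℝ} (hθ : θ ∈ Set.Icc (-Real.pi) Real.pi) :
    (2 / Real.pi * |θ|) ^ 2 ≤ Real.sin θ ^ 2 ∨
      (2 / Real.pi * |(Real.pi - |θ|)|) ^ 2 ≤ Real.sin θ ^ 2 := by
  have hs : Real.sin θ ^ 2 = Real.sin |θ| ^ 2 := by
    rcases abs_choice θ with h | h <;> simp [h]
  have hpi := Real.pi_pos
  have h1 : |θ| ≤ Real.pi := abs_le.2 hθ
  rw [hs]
  rcases le_total |θ| (Real.pi / 2) with h | h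
  · left
    gcongr
    exact Real.mul_le_sin (abs_nonneg _) h
  · right
    rw [abs_of_nonneg (sub_nonneg.2 h1), ← Real.sin_pi_sub |θ|]
    gcongr
    exact Real.mul_le_sin (by linarith) (by linarith)

lemma lintegral_sin_sq_rpow_lt_top {q : ℝ} (hq0 : 0 ≤ q) (hq : q < 1 / 2) :
    ∫⁻ θ in Set.Ioo (-Real.pi) Real.pi, ENNReal.ofReal ((Real.sin θ ^ 2) ^ (-q)) < ⊤ := by
  have hpi := Real.pi_pos
  have hpow : ∀ x : ℝ, ((2 / Real.pi * |x|) ^ 2) ^ (-q) =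
      (2 / Real.pi) ^ (-(2 * q)) * |x| ^ (-(2 * q)) := by
    intro x
    rw [← Real.mul_rpow (by positivity) (abs_nonneg _), ← Real.rpow_natCast,
      ← Real.rpow_mul (by positivity)]
    congr 1; push_cast; ring
  set c : ℝ := (2 / Real.pi) ^ (-(2 * q)) with hc
  have hc0 : 0 ≤ c := by positivity
  -- The three terms control the singularities at `0`, `π` and `-π`.
  have hbound : ∀ θ ∈ Set.Ioo (-Real.pi) Real.pi, ENNReal.ofReal ((Real.sin θ ^ 2) ^ (-q)) ≤
      ENNReal.ofReal c * (ENNReal.ofReal (|θ| ^ (-(2 * q))) +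
        (ENNReal.ofReal (|θ - Real.pi| ^ (-(2 * q))) +
        ENNReal.ofReal (|θ - -Real.pi| ^ (-(2 * q))))) := by
    intro θ hθ
    rw [← ENNReal.ofReal_add (by positivity) (by positivity),
      ← ENNReal.ofReal_add (by positivity) (by positivity), ← ENNReal.ofReal_mul hc0]
    refine ENNReal.ofReal_le_ofReal ?_
    have n1 : 0 ≤ |θ| ^ (-(2 * q)) := by positivity
    have n2 : 0 ≤ |θ - Real.pi| ^ (-(2 * q)) := by positivity
    have n3 : 0 ≤ |θ - -Real.pi| ^ (-(2 * q)) := by positivity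
    by_cases h0 : θ = 0
    · have : (Real.sin θ ^ 2) ^ (-q) ≤ c * |θ| ^ (-(2 * q)) := by
        rw [← hpow]; simp [h0]
      nlinarith [mul_nonneg hc0 n2, mul_nonneg hc0 n3]
    rcases sin_sq_ge (Set.Ioo_subset_Icc_self hθ) with h | h
    · have : (Real.sin θ ^ 2) ^ (-q) ≤ c * |θ| ^ (-(2 * q)) := by
        rw [← hpow]
        have := abs_pos.2 h0
        exact Real.rpow_le_rpow_of_nonpos (by positivity) h (by linarith)
      nlinarith [mul_nonneg hc0 n2, mul_nonneg hc0 n3]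
    · have h2 : (Real.sin θ ^ 2) ^ (-q) ≤ c * |(Real.pi - |θ|)| ^ (-(2 * q)) := by
        rw [← hpow]
        have : 0 < |(Real.pi - |θ|)| := abs_pos.2 (sub_pos.2 (abs_lt.2 hθ)).ne'
        exact Real.rpow_le_rpow_of_nonpos (by positivity) h (by linarith)
      rcases abs_choice θ with h3 | h3
      · rw [h3, abs_sub_comm] at h2
        nlinarith [mul_nonneg hc0 n1, mul_nonneg hc0 n3]
      · rw [h3, show Real.pi - -θ = θ - -Real.pi by ring] at h2
        nlinarith [mul_nonneg hc0 n1, mul_nonneg hc0 n2]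
  have hshift : ∀ a ∈ Set.Icc (-Real.pi) Real.pi, ∫⁻ θ in Set.Ioo (-Real.pi) Real.pi,
      ENNReal.ofReal (|θ - a| ^ (-(2 * q))) < ⊤ := by
    intro a ha
    refine lt_of_le_of_lt ?_ ((lintegral_abs_rpow_neg_le (a := 2 * q) (by linarith)
      (T := 2 * Real.pi) (by positivity)).trans_lt ENNReal.ofReal_lt_top)
    have := (measurePreserving_sub_right volume a).setLIntegral_comp_preimage_emb
      (Homeomorph.subRight a).measurableEmbedding
      (fun x => ENNReal.ofReal (|x| ^ (-(2 * q)))) (Set.Icc (-(2 * Real.pi)) (2 * Real.pi))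
    rw [← this]
    refine lintegral_mono_set fun θ hθ => ?_
    simp only [Set.mem_preimage, Set.mem_Icc, Set.mem_Ioo] at *
    constructor <;> linarith [ha.1, ha.2, hθ.1, hθ.2]
  refine (setLIntegral_mono' measurableSet_Ioo hbound).trans_lt ?_
  rw [lintegral_const_mul _ (by fun_prop), lintegral_add_left (by fun_prop),
    lintegral_add_left (by fun_prop)]
  refine ENNReal.mul_lt_top ENNReal.ofReal_lt_top (ENNReal.add_lt_top.2 ⟨?_,
    ENNReal.add_lt_top.2 ⟨hshift _ ⟨by linarith, le_rfl⟩, hshift _ ⟨le_rfl, by linarith⟩⟩⟩)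
  simpa using hshift 0 ⟨by linarith, hpi.le⟩

lemma tripleWeight_sq (p : ℝ) (y : ℝ × ℝ × ℝ) :
    tripleWeight p y ^ 2 =
      |y.1| ^ ((p - 2) / 3) * |y.2.1| ^ ((p - 2) / 3) * |y.2.2| ^ ((p - 2) / 3) := by
  have h : ∀ x : ℝ, (|x| ^ ((p - 2) / 6)) ^ 2 = |x| ^ ((p - 2) / 3) := fun x => by
    rw [← Real.rpow_natCast, ← Real.rpow_mul (abs_nonneg _)]; congr 1; push_cast; ring
  rw [tripleWeight, mul_pow, mul_pow, h, h, h]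

lemma rpow_third_mul {M : ℝ} (hM : 0 < M) (a : ℝ) :
    M ^ (a / 3) * M ^ (a / 3) * M ^ (a / 3) = M ^ a := by
  rw [← Real.rpow_add hM, ← Real.rpow_add hM]; congr 1; ring

lemma abs_le_maxAbs (y : ℝ × ℝ × ℝ) :
    |y.1| ≤ maxAbs y ∧ |y.2.1| ≤ maxAbs y ∧ |y.2.2| ≤ maxAbs y :=
  ⟨le_max_left _ _, (le_max_left _ _).trans (le_max_right _ _),
    (le_max_right _ _).trans (le_max_right _ _)⟩

/-- For `p ≥ 2` the radial derivative dominates the squared weight. -/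
lemma tripleWeight_sq_mul_sqGap_le {p : ℝ} (hp : 2 ≤ p) (y : ℝ × ℝ × ℝ) :
    tripleWeight p y ^ 2 * sqGap y ≤ 3 / min (p - 1) (1 / 2) / p * (p * powGap p y) := by
  have hmin := min_sub_one_half_pos (show 1 < p by linarith)
  have h1 := powGap_ge (show 1 < p by linarith) y
  rcases (sqGap_nonneg y).eq_or_lt with h0 | h0
  · rw [← h0, mul_zero]
    have := powGap_nonneg (show 1 < p by linarith) y
    positivity
  have hM := maxAbs_pos_of_sqGap_pos h0
  obtain ⟨ha, hb, hc⟩ := abs_le_maxAbs y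
  have hW : tripleWeight p y ^ 2 ≤ maxAbs y ^ (p - 2) := by
    rw [tripleWeight_sq, ← rpow_third_mul hM]
    have : 0 ≤ (p - 2) / 3 := by linarith
    gcongr
  have h2 : 3 / min (p - 1) (1 / 2) / p * (p * powGap p y)
      = 3 / min (p - 1) (1 / 2) * powGap p y := by field_simp
  rw [h2]
  calc tripleWeight p y ^ 2 * sqGap y ≤ maxAbs y ^ (p - 2) * sqGap y := by gcongr
    _ = 3 / min (p - 1) (1 / 2) * (min (p - 1) (1 / 2) / 3 * sqGap y * maxAbs y ^ (p - 2)) := by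
        field_simp
    _ ≤ _ := by gcongr

/-- The squared weight when `1 < p < 2`, at coordinates ordered by absolute value, in the region
close to the diagonal plane `y₂ = y₃`. -/
lemma tripleWeight_sq_le_sin {p : ℝ} (hp2 : p < 2) {ξ θ r : ℝ} {y : ℝ × ℝ × ℝ}
    (hy : y = cylPoint ξ θ r) (hr : 0 < r) (h12 : |y.1| ≤ |y.2.1|) (h23 : |y.2.1| ≤ |y.2.2|)
    (hs : (y.2.1 - y.2.2) ^ 2 ≤ |y.1| * |y.2.2|) (hθ : Real.sin θ ≠ 0) :
    tripleWeight p y ^ 2 ≤ 16 ^ (2 - p) * (1 + (Real.sin θ ^ 2) ^ (-((2 - p) / 3))) *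
      |y.2.2| ^ (p - 2) := by
  have hgap : sqGap y = 3 * r ^ 2 := by rw [hy, sqGap_cylPoint]
  have hs' : (y.2.1 - y.2.2) ^ 2 = 2 * r ^ 2 * Real.sin θ ^ 2 := by
    rw [hy]; simp only [cylPoint]
    linear_combination r ^ 2 * planeUnit₂_sub_planeUnit₃_sq θ
  obtain ⟨a, b, c⟩ := y
  simp only at *
  have hM : 0 < |c| := by
    by_contra! h
    have hc := abs_nonpos_iff.1 h
    have hb := abs_nonpos_iff.1 (h23.trans h)
    have ha := abs_nonpos_iff.1 (h12.trans (h23.trans h))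
    simp [sqGap, ha, hb, hc] at hgap
    exact hr.ne' hgap
  have hsin : 0 < Real.sin θ ^ 2 := by positivity
  have hsn : 0 ≤ (Real.sin θ ^ 2) ^ (-((2 - p) / 3)) := by positivity
  rw [tripleWeight_sq]
  simp only
  have hneg : (p - 2) / 3 ≤ 0 := by linarith
  rcases le_or_gt (|c| / 16) |a| with ha | ha
  · -- All three coordinates are comparable.
    have h16 : ((|c| / 16) ^ ((p - 2) / 3)) * ((|c| / 16) ^ ((p - 2) / 3)) *
        ((|c| / 16) ^ ((p - 2) / 3)) = 16 ^ (2 - p) * |c| ^ (p - 2) := by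
      rw [rpow_third_mul (by positivity), Real.div_rpow hM.le (by norm_num),
        show 2 - p = -(p - 2) by ring, Real.rpow_neg (by norm_num)]
      field_simp
    calc _ ≤ ((|c| / 16) ^ ((p - 2) / 3)) * ((|c| / 16) ^ ((p - 2) / 3)) *
          ((|c| / 16) ^ ((p - 2) / 3)) := by
          have hc16 : 0 < |c| / 16 := by positivity
          gcongr ?_ * ?_ * ?_
          · exact Real.rpow_le_rpow_of_nonpos hc16 ha hneg
          · exact Real.rpow_le_rpow_of_nonpos hc16 (ha.trans h12) hneg
          · exact Real.rpow_le_rpow_of_nonpos hc16 (by linarith) hneg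
      _ = 16 ^ (2 - p) * 1 * |c| ^ (p - 2) := by rw [h16]; ring
      _ ≤ _ := by gcongr; linarith
  · -- Only the first coordinate is small, and it is at least comparable to `|c| sin² θ`.
    have hcb : |c| / 16 ≤ |b| := by
      by_contra! h
      have h1 : |c| - |b| ≤ |b - c| := by
        rw [abs_sub_comm]; exact abs_sub_abs_le_abs_sub c b
      have h2 : (b - c) ^ 2 = |b - c| ^ 2 := (sq_abs _).symm
      nlinarith [abs_nonneg a]
    have hca : |c| / 2 ≤ |a - c| := by
      have h1 : |c| - |a| ≤ |a - c| := by
        rw [abs_sub_comm]; exact abs_sub_abs_le_abs_sub c a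
      linarith
    have hr2 : |c| ^ 2 / 12 ≤ r ^ 2 := by
      have h2 : (a - c) ^ 2 = |a - c| ^ 2 := (sq_abs _).symm
      have h3 : (|c| / 2) ^ 2 ≤ |a - c| ^ 2 := by gcongr
      simp only [sqGap] at hgap
      nlinarith [sq_nonneg (a - b), sq_nonneg (b - c)]
    have hlow : |c| / 16 * Real.sin θ ^ 2 ≤ |a| := by
      have h1 : |c| ^ 2 / 6 * Real.sin θ ^ 2 ≤ |a| * |c| := by
        calc _ = 2 * (|c| ^ 2 / 12) * Real.sin θ ^ 2 := by ring
          _ ≤ 2 * r ^ 2 * Real.sin θ ^ 2 := by gcongr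
          _ ≤ _ := by rw [← hs']; exact hs
      have h2 : |c| / 6 * Real.sin θ ^ 2 ≤ |a| := by
        refine le_of_mul_le_mul_right ?_ hM
        calc _ = |c| ^ 2 / 6 * Real.sin θ ^ 2 := by ring
          _ ≤ _ := h1
      refine le_trans ?_ h2
      gcongr
      norm_num
    have h16 : (|c| / 16 * Real.sin θ ^ 2) ^ ((p - 2) / 3) * ((|c| / 16) ^ ((p - 2) / 3)) *
        ((|c| / 16) ^ ((p - 2) / 3)) =
        16 ^ (2 - p) * (Real.sin θ ^ 2) ^ (-((2 - p) / 3)) * |c| ^ (p - 2) := by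
      rw [Real.mul_rpow (by positivity) hsin.le, show -((2 - p) / 3) = (p - 2) / 3 by ring]
      have : ((|c| / 16) ^ ((p - 2) / 3)) * ((|c| / 16) ^ ((p - 2) / 3)) *
        ((|c| / 16) ^ ((p - 2) / 3)) = 16 ^ (2 - p) * |c| ^ (p - 2) := by
        rw [rpow_third_mul (by positivity), Real.div_rpow hM.le (by norm_num),
          show 2 - p = -(p - 2) by ring, Real.rpow_neg (by norm_num)]
        field_simp
      linear_combination (Real.sin θ ^ 2) ^ ((p - 2) / 3) * this
    calc _ ≤ (|c| / 16 * Real.sin θ ^ 2) ^ ((p - 2) / 3) * ((|c| / 16) ^ ((p - 2) / 3)) *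
          ((|c| / 16) ^ ((p - 2) / 3)) := by
          have hc16 : 0 < |c| / 16 := by positivity
          gcongr ?_ * ?_ * ?_
          · exact Real.rpow_le_rpow_of_nonpos (by positivity) hlow hneg
          · exact Real.rpow_le_rpow_of_nonpos hc16 hcb hneg
          · exact Real.rpow_le_rpow_of_nonpos hc16 (by linarith) hneg
      _ = _ := h16
      _ ≤ _ := by gcongr; linarith

/-- The squared weight when `1 < p < 2`, at coordinates ordered by absolute value, in the region
away from the diagonal plane `y₂ = y₃`. -/
lemma tripleWeight_sq_le_jacobian {p : ℝ} (hp : 1 < p) (hp2 : p < 2) {y : ℝ × ℝ × ℝ}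
    (h12 : |y.1| ≤ |y.2.1|) (h23 : |y.2.1| ≤ |y.2.2|)
    (hs : |y.1| * |y.2.2| < (y.2.1 - y.2.2) ^ 2) :
    tripleWeight p y ^ 2 ≤ 2 / (p * min (p - 1) (1 / 2)) * |y.1| ^ (-((2 - p) / 3 + 1 / 2)) *
      |y.2.2| ^ ((2 - p) / 3 - 1 / 2) * (p * |oddPow p y.2.2 - oddPow p y.2.1|) := by
  obtain ⟨a, b, c⟩ := y
  simp only at *
  have hmin := min_sub_one_half_pos hp
  rw [tripleWeight_sq]
  simp only
  have hexp : (p - 2) / 3 ≠ 0 := by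
    have : p - 2 < 0 := by linarith
    exact (by linarith : (p - 2) / 3 < 0).ne
  have hneg : (p - 2) / 3 ≤ 0 := by linarith
  rcases (abs_nonneg a).eq_or_lt with ha | ha
  · rw [← ha, Real.zero_rpow hexp]
    have h1 : (0 : ℝ) ≤ 0 ^ (-((2 - p) / 3 + 1 / 2)) := Real.rpow_nonneg le_rfl _
    simp only [zero_mul]
    positivity
  have hb : 0 < |b| := ha.trans_le h12
  have hc : 0 < |c| := hb.trans_le h23
  set s := |c - b| with hsdef
  have hs2 : (b - c) ^ 2 = s ^ 2 := by rw [hsdef, sq_abs]; ring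
  rw [hs2] at hs
  have hspos : 0 < s := by
    have : 0 < |a| * |c| := by positivity
    by_contra! h
    have : s = 0 := le_antisymm h (abs_nonneg _)
    rw [this] at hs; simp at hs; linarith
  -- The Jacobian is at least of size `s |c|^(p-2)`.
  have hJ : min (p - 1) (1 / 2) * s * |c| ^ (p - 2) ≤ |oddPow p c - oddPow p b| := by
    have h1 := oddPow_sub_mul_sub_ge hp h23
    have h2 : (c - b) * (oddPow p c - oddPow p b) ≤ s * |oddPow p c - oddPow p b| := by
      rw [hsdef, ← abs_mul]; exact le_abs_self _
    have h3 : (c - b) ^ 2 = s ^ 2 := by rw [hsdef, sq_abs]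
    rw [h3] at h1
    refine le_of_mul_le_mul_left ?_ hspos
    linarith
  have hsq : |a| ^ (1 / 2 : ℝ) * |c| ^ (1 / 2 : ℝ) ≤ s := by
    rw [← Real.mul_rpow ha.le hc.le, ← Real.sqrt_eq_rpow]
    exact Real.sqrt_le_iff.2 ⟨hspos.le, hs.le⟩
  have key : |a| ^ ((p - 2) / 3) * |b| ^ ((p - 2) / 3) * |c| ^ ((p - 2) / 3) ≤
      2 * |a| ^ (-((2 - p) / 3 + 1 / 2)) * |c| ^ ((2 - p) / 3 - 1 / 2) * (s * |c| ^ (p - 2)) := by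
    rcases le_or_gt (|c| / 2) |b| with hbc | hbc
    · calc _ ≤ |a| ^ ((p - 2) / 3) * (|c| / 2) ^ ((p - 2) / 3) * |c| ^ ((p - 2) / 3) := by
            gcongr ?_ * ?_ * ?_
            exact Real.rpow_le_rpow_of_nonpos (by positivity) hbc hneg
        _ ≤ |a| ^ ((p - 2) / 3) * (2 * |c| ^ ((p - 2) / 3)) * |c| ^ ((p - 2) / 3) := by
            gcongr
            rw [Real.div_rpow hc.le (by norm_num), div_eq_mul_inv, mul_comm,
              ← Real.rpow_neg (by norm_num)]
            gcongr
            calc (2 : ℝ) ^ (-((p - 2) / 3)) ≤ 2 ^ (1 : ℝ) :=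
                  Real.rpow_le_rpow_of_exponent_le (by norm_num) (by linarith)
              _ = 2 := Real.rpow_one 2
        _ = 2 * |a| ^ (-((2 - p) / 3 + 1 / 2)) * |c| ^ ((2 - p) / 3 - 1 / 2) *
            ((|a| ^ (1 / 2 : ℝ) * |c| ^ (1 / 2 : ℝ)) * |c| ^ (p - 2)) := by
            have e1 : |a| ^ ((p - 2) / 3) = |a| ^ (-((2 - p) / 3 + 1 / 2)) * |a| ^ (1 / 2 : ℝ) := by
              rw [← Real.rpow_add ha]; congr 1; ring
            have e2 : |c| ^ ((p - 2) / 3) * |c| ^ ((p - 2) / 3) =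
                |c| ^ ((2 - p) / 3 - 1 / 2) * |c| ^ (1 / 2 : ℝ) * |c| ^ (p - 2) := by
              rw [← Real.rpow_add hc, ← Real.rpow_add hc, ← Real.rpow_add hc]; congr 1; ring
            rw [e1]
            linear_combination 2 * |a| ^ (-((2 - p) / 3 + 1 / 2)) * |a| ^ (1 / 2 : ℝ) * e2
        _ ≤ _ := by gcongr
    · have hsc : |c| / 2 ≤ s := by
        have := abs_sub_abs_le_abs_sub c b
        rw [hsdef]; linarith
      calc _ ≤ |a| ^ ((p - 2) / 3) * |a| ^ ((p - 2) / 3) * |c| ^ ((p - 2) / 3) := by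
            gcongr ?_ * ?_ * ?_
            exact Real.rpow_le_rpow_of_nonpos ha h12 hneg
        _ = |a| ^ (-((2 - p) / 3 + 1 / 2)) * |c| ^ ((p - 2) / 3) *
            |a| ^ ((p - 2) / 3 + 1 / 2) := by
            have : |a| ^ ((p - 2) / 3) * |a| ^ ((p - 2) / 3) =
                |a| ^ (-((2 - p) / 3 + 1 / 2)) * |a| ^ ((p - 2) / 3 + 1 / 2) := by
              rw [← Real.rpow_add ha, ← Real.rpow_add ha]; congr 1; ring
            rw [this]; ring
        _ ≤ |a| ^ (-((2 - p) / 3 + 1 / 2)) * |c| ^ ((p - 2) / 3) *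
            |c| ^ ((p - 2) / 3 + 1 / 2) := by
            gcongr ?_ * ?_
            exact Real.rpow_le_rpow ha.le (h12.trans h23) (by linarith)
        _ = 2 * |a| ^ (-((2 - p) / 3 + 1 / 2)) * |c| ^ ((2 - p) / 3 - 1 / 2) *
            (|c| / 2 * |c| ^ (p - 2)) := by
            have : |c| ^ ((p - 2) / 3) * |c| ^ ((p - 2) / 3 + 1 / 2) =
                |c| ^ ((2 - p) / 3 - 1 / 2) * (|c| ^ (1 : ℝ) * |c| ^ (p - 2)) := by
              rw [← Real.rpow_add hc, ← Real.rpow_add hc, ← Real.rpow_add hc]; congr 1; ring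
            rw [Real.rpow_one] at this
            linear_combination |a| ^ (-((2 - p) / 3 + 1 / 2)) * this
        _ ≤ _ := by gcongr
  refine key.trans ?_
  calc _ = 2 / (p * min (p - 1) (1 / 2)) * |a| ^ (-((2 - p) / 3 + 1 / 2)) *
        |c| ^ ((2 - p) / 3 - 1 / 2) * (p * (min (p - 1) (1 / 2) * s * |c| ^ (p - 2))) := by
        field_simp
    _ ≤ _ := by gcongr

lemma lintegral_swap_fst {G : ℝ × ℝ × ℝ → ENNReal} (hG : Measurable G) :
    ∫⁻ y : ℝ × ℝ × ℝ, G (y.2.1, y.1, y.2.2) = ∫⁻ y, G y := by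
  rw [lintegral_triple hG, lintegral_triple (by fun_prop)]
  exact lintegral_lintegral_swap (by fun_prop)

lemma lintegral_swap_snd {G : ℝ × ℝ × ℝ → ENNReal} (hG : Measurable G) :
    ∫⁻ y : ℝ × ℝ × ℝ, G (y.1, y.2.2, y.2.1) = ∫⁻ y, G y := by
  rw [lintegral_triple hG, lintegral_triple (by fun_prop)]
  exact lintegral_congr fun a => lintegral_lintegral_swap (by fun_prop)

/-- The points whose coordinates increase in absolute value. -/
def absOrdered : Set (ℝ × ℝ × ℝ) := {y | |y.1| ≤ |y.2.1| ∧ |y.2.1| ≤ |y.2.2|}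

lemma measurableSet_absOrdered : MeasurableSet absOrdered :=
  (measurableSet_le (f := fun y : ℝ × ℝ × ℝ => |y.1|) (g := fun y => |y.2.1|)
    (by fun_prop) (by fun_prop)).inter
    (measurableSet_le (f := fun y : ℝ × ℝ × ℝ => |y.2.1|) (g := fun y => |y.2.2|)
      (by fun_prop) (by fun_prop))

/-- The integral of a symmetric function is at most six times the integral over the points with
ordered coordinates. -/
lemma lintegral_le_six_mul_absOrdered {F : ℝ × ℝ × ℝ → ENNReal} (hF : Measurable F)
    (h12 : ∀ a b c, F (b, a, c) = F (a, b, c)) (h23 : ∀ a b c, F (a, c, b) = F (a, b, c)) :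
    ∫⁻ y, F y ≤ 6 * ∫⁻ y in absOrdered, F y := by
  set G := absOrdered.indicator F with hGdef
  have hG : Measurable G := hF.indicator measurableSet_absOrdered
  have hle : ∀ y : ℝ × ℝ × ℝ, F y ≤ G y + G (y.1, y.2.2, y.2.1) + G (y.2.1, y.1, y.2.2) +
      G (y.2.1, y.2.2, y.1) + G (y.2.2, y.1, y.2.1) + G (y.2.2, y.2.1, y.1) := by
    rintro ⟨a, b, c⟩
    have key : ∀ x y z, |x| ≤ |y| → |y| ≤ |z| → G (x, y, z) = F (x, y, z) := fun x y z h h' =>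
      Set.indicator_of_mem (show (x, y, z) ∈ absOrdered from ⟨h, h'⟩) F
    have e2 : F (a, c, b) = F (a, b, c) := h23 a b c
    have e3 : F (b, a, c) = F (a, b, c) := h12 a b c
    have e4 : F (b, c, a) = F (a, b, c) := by rw [h23 b a c, e3]
    have e5 : F (c, a, b) = F (a, b, c) := by rw [h12 a c b, e2]
    have e6 : F (c, b, a) = F (a, b, c) := by rw [h23 c a b, e5]
    dsimp only
    rcases le_total |a| |b| with h1 | h1 <;> rcases le_total |b| |c| with h2 | h2 <;>
      rcases le_total |a| |c| with h3 | h3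
    · rw [key a b c h1 h2]; simp only [add_assoc]; exact le_self_add
    · rw [key a b c h1 h2]; simp only [add_assoc]; exact le_self_add
    · rw [key a c b h3 h2, e2]; simp only [add_assoc]; exact le_add_left le_self_add
    · rw [key c a b h3 h1, e5]; exact le_add_right le_add_self
    · rw [key b a c h1 h3, e3]; simp only [add_assoc]; exact le_add_left (le_add_left le_self_add)
    · rw [key b c a h2 h3, e4]; exact le_add_right (le_add_right le_add_self)
    · rw [key c b a h2 h1, e6]; exact le_add_self
    · rw [key c b a h2 h1, e6]; exact le_add_self
  have i2 : ∫⁻ y : ℝ × ℝ × ℝ, G (y.1, y.2.2, y.2.1) = ∫⁻ y, G y := lintegral_swap_snd hG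
  have i3 : ∫⁻ y : ℝ × ℝ × ℝ, G (y.2.1, y.1, y.2.2) = ∫⁻ y, G y := lintegral_swap_fst hG
  have i4 : ∫⁻ y : ℝ × ℝ × ℝ, G (y.2.1, y.2.2, y.1) = ∫⁻ y, G y :=
    (lintegral_swap_fst (G := fun y => G (y.1, y.2.2, y.2.1)) (by fun_prop)).trans i2
  have i5 : ∫⁻ y : ℝ × ℝ × ℝ, G (y.2.2, y.1, y.2.1) = ∫⁻ y, G y :=
    (lintegral_swap_snd (G := fun y => G (y.2.1, y.1, y.2.2)) (by fun_prop)).trans i3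
  have i6 : ∫⁻ y : ℝ × ℝ × ℝ, G (y.2.2, y.2.1, y.1) = ∫⁻ y, G y :=
    (lintegral_swap_fst (G := fun y => G (y.2.2, y.1, y.2.1)) (by fun_prop)).trans i5
  refine (lintegral_mono hle).trans ?_
  rw [lintegral_add_left (by fun_prop), lintegral_add_left (by fun_prop),
    lintegral_add_left (by fun_prop), lintegral_add_left (by fun_prop),
    lintegral_add_left (by fun_prop), i2, i3, i4, i5, i6, hGdef,
    lintegral_indicator measurableSet_absOrdered]
  apply le_of_eq; ring

lemma maxAbs_of_mem_absOrdered {y : ℝ × ℝ × ℝ} (h : y ∈ absOrdered) : maxAbs y = |y.2.2| := by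
  rw [maxAbs, max_eq_right h.2, max_eq_right (h.1.trans h.2)]

/-- The contribution of the region close to the plane `y₂ = y₃`, which contains the neighbourhood
of the diagonal, is bounded in cylindrical coordinates. -/
lemma exists_setLIntegral_nearDiag_le {p : ℝ} (hp : 1 < p) (hp2 : p < 2) :
    ∃ C : ENNReal, C ≠ ⊤ ∧ ∀ Ψ : ℝ × ℝ → ENNReal, Measurable Ψ →
      ∫⁻ y in absOrdered ∩ {y | (y.2.1 - y.2.2) ^ 2 ≤ |y.1| * |y.2.2|},
        ENNReal.ofReal (tripleWeight p y ^ 2) * Ψ (curveSum p y) ≤ C * ∫⁻ x, Ψ x := by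
  have hmin := min_sub_one_half_pos hp
  set A : ℝ := 16 ^ (2 - p) * (3 / min (p - 1) (1 / 2) / p) with hA
  have hA0 : 0 ≤ A := by positivity
  set k : ℝ → ENNReal := fun θ => if Real.sin θ = 0 then ⊤ else
    ENNReal.ofReal A * (1 + ENNReal.ofReal ((Real.sin θ ^ 2) ^ (-((2 - p) / 3)))) with hk
  have hkm : Measurable k :=
    Measurable.ite (measurableSet_eq_fun (by fun_prop) (by fun_prop)) measurable_const (by fun_prop)
  have hkint : ∫⁻ θ in Set.Ioo (-Real.pi) Real.pi, k θ < ⊤ := by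
    have h1 : ∫⁻ θ in Set.Ioo (-Real.pi) Real.pi, k θ = ∫⁻ θ in Set.Ioo (-Real.pi) Real.pi,
        ENNReal.ofReal A * (1 + ENNReal.ofReal ((Real.sin θ ^ 2) ^ (-((2 - p) / 3)))) := by
      refine lintegral_congr_ae ?_
      have h0 : ∀ᵐ θ : ℝ ∂(volume.restrict (Set.Ioo (-Real.pi) Real.pi)), θ ≠ 0 :=
        ae_restrict_of_ae (Measure.ae_ne volume 0)
      filter_upwards [h0, ae_restrict_mem measurableSet_Ioo] with θ h0 hθ
      have : Real.sin θ ≠ 0 := fun h =>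
        h0 ((Real.sin_eq_zero_iff_of_lt_of_lt hθ.1 hθ.2).1 h)
      simp only [hk, if_neg this]
    rw [h1, lintegral_const_mul _ (by fun_prop), lintegral_add_left (by fun_prop)]
    refine ENNReal.mul_lt_top ENNReal.ofReal_lt_top (ENNReal.add_lt_top.2 ⟨?_,
      lintegral_sin_sq_rpow_lt_top (by linarith) (by linarith)⟩)
    simp
  refine ⟨ENNReal.ofReal (1 / √3) * ∫⁻ θ in Set.Ioo (-Real.pi) Real.pi, k θ,
    ENNReal.mul_ne_top ENNReal.ofReal_ne_top hkint.ne, fun Ψ hΨ =>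
    setLIntegral_curveSum_le_of_angle hp (measurableSet_absOrdered.inter
      (measurableSet_le (by fun_prop) (by fun_prop))) hkm ?_ hΨ⟩
  rintro ξ θ r hr ⟨hy, hs⟩
  have hpow : 0 < p * powGap p (cylPoint ξ θ r) := by
    rw [← mul_rayHeightDeriv]
    have := rayHeightDeriv_pos hp ξ θ hr
    positivity
  by_cases hθ : Real.sin θ = 0
  · simp only [hk, if_pos hθ]
    rw [ENNReal.top_mul (by simpa using hpow)]
    exact le_top
  · simp only [hk, if_neg hθ]
    have h1 := tripleWeight_sq_le_sin hp2 rfl hr hy.1 hy.2 hs hθ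
    have h2 := powGap_ge hp (cylPoint ξ θ r)
    rw [maxAbs_of_mem_absOrdered hy] at h2
    have h3 := sqGap_nonneg (cylPoint ξ θ r)
    rw [show (1 : ENNReal) = ENNReal.ofReal 1 by simp,
      ← ENNReal.ofReal_add (by norm_num) (by positivity), ← ENNReal.ofReal_mul hA0,
      ← ENNReal.ofReal_mul (by positivity)]
    refine ENNReal.ofReal_le_ofReal ?_
    set z := cylPoint ξ θ r
    set S := 1 + (Real.sin θ ^ 2) ^ (-((2 - p) / 3)) with hS
    have hS0 : 0 ≤ S := by positivity
    calc tripleWeight p z ^ 2 * sqGap z ≤ 16 ^ (2 - p) * S * |z.2.2| ^ (p - 2) * sqGap z := by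
          gcongr
      _ = 16 ^ (2 - p) * S * (3 / min (p - 1) (1 / 2)) *
          (min (p - 1) (1 / 2) / 3 * sqGap z * |z.2.2| ^ (p - 2)) := by field_simp
      _ ≤ 16 ^ (2 - p) * S * (3 / min (p - 1) (1 / 2)) * powGap p z := by gcongr
      _ = A * S * (p * powGap p z) := by rw [hA]; field_simp

/-- The contribution of the region away from the plane `y₂ = y₃` is bounded in the coordinates
given by `y₁`, the sum of the coordinates, and the height. -/
lemma exists_setLIntegral_farDiag_le {p : ℝ} (hp : 1 < p) (hp2 : p < 2) :
    ∃ C : ENNReal, C ≠ ⊤ ∧ ∀ Ψ : ℝ × ℝ → ENNReal, Measurable Ψ →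
      ∫⁻ y in absOrdered ∩ {y | |y.1| * |y.2.2| < (y.2.1 - y.2.2) ^ 2},
        ENNReal.ofReal (tripleWeight p y ^ 2) * Ψ (curveSum p y) ≤ C * ∫⁻ x, Ψ x := by
  have hmin := min_sub_one_half_pos hp
  set A : ℝ := 2 / (p * min (p - 1) (1 / 2)) with hA
  have hA0 : 0 ≤ A := by positivity
  set e : ℝ := (2 - p) / 3 + 1 / 2 with he
  have he1 : e < 1 := by rw [he]; linarith
  -- `(t / 3) ^ (1 / p)` lies between the smallest and the largest absolute value of a coordinate.
  set k : ℝ → ℝ → ENNReal := fun x t => if 0 < t ∧ |x| ≤ (t / 3) ^ (1 / p) then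
    ENNReal.ofReal (A * |x| ^ (-e) * ((t / 3) ^ (1 / p)) ^ (e - 1)) else 0 with hk
  have hkm : Measurable (Function.uncurry k) :=
    Measurable.ite ((measurableSet_lt (f := fun _ : ℝ × ℝ => (0 : ℝ)) (g := fun x => x.2)
      (by fun_prop) (by fun_prop)).inter (measurableSet_le (f := fun x : ℝ × ℝ => |x.1|)
      (g := fun x => (x.2 / 3) ^ (1 / p)) (by fun_prop) (by fun_prop))) (by fun_prop) (by fun_prop)
  have hkC : ∀ t, ∫⁻ x, k x t ≤ ENNReal.ofReal (A * (2 / (1 - e))) := by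
    intro t
    rcases le_or_gt t 0 with ht | ht
    · simp [hk, not_lt.2 ht]
    set T := (t / 3) ^ (1 / p) with hT
    have hT0 : 0 < T := by positivity
    have h1 : ∀ x, k x t = (Set.Icc (-T) T).indicator
        (fun x => ENNReal.ofReal (A * T ^ (e - 1)) * ENNReal.ofReal (|x| ^ (-e))) x := by
      intro x
      simp only [hk, ht, true_and, Set.indicator, Set.mem_Icc, ← abs_le, ← hT]
      congr 1
      rw [← ENNReal.ofReal_mul (by positivity)]
      congr 1; ring
    simp_rw [h1]
    rw [lintegral_indicator measurableSet_Icc, lintegral_const_mul _ (by fun_prop)]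
    refine (mul_le_mul' le_rfl (lintegral_abs_rpow_neg_le he1 hT0.le)).trans ?_
    rw [← ENNReal.ofReal_mul (by positivity)]
    apply le_of_eq; congr 1
    have : T ^ (e - 1) * T ^ (1 - e) = 1 := by rw [← Real.rpow_add hT0]; simp
    linear_combination A * (2 / (1 - e)) * this
  refine ⟨2 * ENNReal.ofReal (A * (2 / (1 - e))),
    ENNReal.mul_ne_top (by simp) ENNReal.ofReal_ne_top, fun Ψ hΨ =>
    setLIntegral_curveSum_le_of_coord hp (measurableSet_absOrdered.inter
      (measurableSet_lt (by fun_prop) (by fun_prop))) hkm ?_ hkC hΨ⟩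
  rintro ⟨a, b, c⟩ ⟨⟨h12, h23⟩, hs⟩
  have h1 := tripleWeight_sq_le_jacobian hp hp2 h12 h23 hs
  simp only [Set.mem_ofPred_eq] at h12 h23 hs h1
  have hp0 : 0 < p := by linarith
  have hc : 0 < |c| := by
    by_contra! h
    have hc := abs_nonpos_iff.1 h
    have hb := abs_nonpos_iff.1 (h23.trans h)
    simp [hb, hc] at hs
  set t := (curveSum p (a, b, c)).2 with ht
  have ht' : t = |a| ^ p + |b| ^ p + |c| ^ p := rfl
  have hac : |a| ^ p ≤ |b| ^ p := Real.rpow_le_rpow (abs_nonneg _) h12 hp0.le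
  have hbc : |b| ^ p ≤ |c| ^ p := Real.rpow_le_rpow (abs_nonneg _) h23 hp0.le
  have hcp : 0 < |c| ^ p := by positivity
  have ha0 : 0 ≤ |a| ^ p := by positivity
  have hb0 : 0 ≤ |b| ^ p := by positivity
  have ht0 : 0 < t := by rw [ht']; linarith
  set T := (t / 3) ^ (1 / p) with hT
  have hT0 : 0 < T := by positivity
  have haT : |a| ≤ T := by
    rw [hT, one_div, Real.le_rpow_inv_iff_of_pos (abs_nonneg _) (by positivity) hp0]; linarith
  have hTc : T ≤ |c| := by
    rw [hT, one_div, Real.rpow_inv_le_iff_of_pos (by positivity) (abs_nonneg _) hp0]; linarith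
  simp only [hk]
  rw [if_pos ⟨ht0, haT⟩, ← ENNReal.ofReal_mul (by positivity)]
  refine ENNReal.ofReal_le_ofReal (h1.trans ?_)
  rw [show (2 - p) / 3 - 1 / 2 = e - 1 by rw [he]; ring]
  gcongr ?_ * ?_ * ?_ * ?_
  exact Real.rpow_le_rpow_of_nonpos hT0 hTc (by linarith)

/-- The triple convolution of the measure with the squared weight on the curve has a bounded
density. -/
theorem exists_lintegral_curveSum_le {p : ℝ} (hp : 1 < p) :
    ∃ C : ENNReal, C ≠ ⊤ ∧ ∀ Ψ : ℝ × ℝ → ENNReal, Measurable Ψ →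
      ∫⁻ y, ENNReal.ofReal (tripleWeight p y ^ 2) * Ψ (curveSum p y) ≤ C * ∫⁻ x, Ψ x := by
  have hmin := min_sub_one_half_pos hp
  rcases le_or_gt 2 p with hp2 | hp2
  · refine ⟨ENNReal.ofReal (1 / √3) * ∫⁻ _ in Set.Ioo (-Real.pi) Real.pi,
      ENNReal.ofReal (3 / min (p - 1) (1 / 2) / p), ?_, fun Ψ hΨ => ?_⟩
    · refine ENNReal.mul_ne_top ENNReal.ofReal_ne_top ?_
      simp [ENNReal.mul_eq_top]
    · have := setLIntegral_curveSum_le_of_angle hp MeasurableSet.univ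
        (k := fun _ => ENNReal.ofReal (3 / min (p - 1) (1 / 2) / p)) measurable_const
        (fun ξ θ r _ _ => by
          rw [← ENNReal.ofReal_mul (by positivity)]
          exact ENNReal.ofReal_le_ofReal (tripleWeight_sq_mul_sqGap_le hp2 _)) hΨ
      rwa [Measure.restrict_univ] at this
  · obtain ⟨C₁, hC₁, H₁⟩ := exists_setLIntegral_nearDiag_le hp hp2
    obtain ⟨C₂, hC₂, H₂⟩ := exists_setLIntegral_farDiag_le hp hp2
    refine ⟨6 * (C₁ + C₂), ENNReal.mul_ne_top (by simp) (ENNReal.add_ne_top.2 ⟨hC₁, hC₂⟩),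
      fun Ψ hΨ => ?_⟩
    refine (lintegral_le_six_mul_absOrdered (by fun_prop) ?_ ?_).trans ?_
    · intro a b c
      have h1 : tripleWeight p (b, a, c) = tripleWeight p (a, b, c) := by
        simp only [tripleWeight]; ring
      have h2 : curveSum p (b, a, c) = curveSum p (a, b, c) := by
        simp only [curveSum]; congr 1 <;> ring
      simp only [h1, h2]
    · intro a b c
      have h1 : tripleWeight p (a, c, b) = tripleWeight p (a, b, c) := by
        simp only [tripleWeight]; ring
      have h2 : curveSum p (a, c, b) = curveSum p (a, b, c) := by
        simp only [curveSum]; congr 1 <;> ring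
      simp only [h1, h2]
    · rw [mul_assoc, add_mul]
      gcongr
      refine le_trans ?_ (add_le_add (H₁ Ψ hΨ) (H₂ Ψ hΨ))
      refine (lintegral_mono_set fun y hy => ?_).trans (lintegral_union_le _ _ _)
      rcases le_or_gt ((y.2.1 - y.2.2) ^ 2) (|y.1| * |y.2.2|) with h | h
      · exact Or.inl ⟨hy, h⟩
      · exact Or.inr ⟨hy, h⟩

/-! ### Square integrals -/

section SquareIntegrals

variable {α : Type*} [MeasurableSpace α] {μ : Measure α}

lemma eLpNorm_two_sq {E : Type*} [NormedAddCommGroup E] (f : α → E) :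
    eLpNorm f 2 μ ^ 2 = ∫⁻ x, ‖f x‖ₑ ^ 2 ∂μ := by
  have := eLpNorm_nnreal_pow_eq_lintegral (μ := μ) (f := f) (p := 2) (by norm_num)
  simpa using this

lemma lintegral_mul_sq_le {f g : α → ENNReal} (hf : AEMeasurable f μ) (hg : AEMeasurable g μ) :
    (∫⁻ x, f x * g x ∂μ) ^ 2 ≤ (∫⁻ x, f x ^ 2 ∂μ) * ∫⁻ x, g x ^ 2 ∂μ := by
  have h := ENNReal.lintegral_mul_le_Lp_mul_Lq μ Real.HolderConjugate.two_two hf hg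
  have h2 : ∀ a : ENNReal, (a ^ (1 / 2 : ℝ)) ^ 2 = a := fun a => by
    rw [← ENNReal.rpow_natCast, ← ENNReal.rpow_mul]; norm_num
  calc _ ≤ _ := pow_le_pow_left' h 2
    _ = _ := by
      rw [mul_pow, h2, h2]
      simp only [ENNReal.rpow_two]

end SquareIntegrals

/-! ### The triple convolution as a functional on `L²(ℝ²)` -/

/-- The product `f(y₁) f(y₂) f(y₃)`. -/
def tensorCube (f : ℝ → ℂ) (y : ℝ × ℝ × ℝ) : ℂ := f y.1 * f y.2.1 * f y.2.2

/-- The functional `φ ↦ ∫ φ(∑ yᵢ, ∑ |yᵢ|^p) f(y₁) f(y₂) f(y₃) ∏ |yᵢ|^((p-2)/6) dy`. -/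
noncomputable def tripleFunctional (p : ℝ) (f : ℝ → ℂ) (φ : ℝ × ℝ → ℂ) : ℂ :=
  ∫ y, φ (curveSum p y) * (tripleWeight p y * tensorCube f y)

lemma integral_sigmaMeasure_prod (p : ℝ) (Φ : (ℝ × ℝ) × (ℝ × ℝ) × (ℝ × ℝ) → ℂ) :
    ∫ z, Φ z ∂((sigmaMeasure p).prod ((sigmaMeasure p).prod (sigmaMeasure p))) =
      ∫ y : ℝ × ℝ × ℝ, tripleWeight p y *
        Φ ((y.1, |y.1| ^ p), (y.2.1, |y.2.1| ^ p), (y.2.2, |y.2.2| ^ p)) := by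
  have hc : Measurable fun y : ℝ => (y, |y| ^ p) := by fun_prop
  have hi : Function.Injective fun y : ℝ => (y, |y| ^ p) := fun a b h => congrArg Prod.fst h
  have he : MeasurableEmbedding fun y : ℝ => (y, |y| ^ p) := hc.measurableEmbedding hi
  have hw : Measurable fun y : ℝ => ENNReal.ofReal (|y| ^ ((p - 2) / 6)) := by fun_prop
  unfold sigmaMeasure
  rw [Measure.map_prod_map _ _ hc hc, Measure.map_prod_map _ _ hc (hc.prodMap hc),
    (he.prodMap (he.prodMap he)).integral_map, prod_withDensity hw hw,
    prod_withDensity hw (by fun_prop), ← Measure.volume_eq_prod, ← Measure.volume_eq_prod,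
    integral_withDensity_eq_integral_toReal_smul (by fun_prop)
      (Eventually.of_forall fun y => ENNReal.mul_lt_top ENNReal.ofReal_lt_top
        (ENNReal.mul_lt_top ENNReal.ofReal_lt_top ENNReal.ofReal_lt_top))]
  refine integral_congr_ae (Eventually.of_forall fun y => ?_)
  have h : (ENNReal.ofReal (|y.1| ^ ((p - 2) / 6)) * (ENNReal.ofReal (|y.2.1| ^ ((p - 2) / 6)) *
      ENNReal.ofReal (|y.2.2| ^ ((p - 2) / 6)))).toReal = tripleWeight p y := by
    rw [ENNReal.toReal_mul, ENNReal.toReal_mul, ENNReal.toReal_ofReal (by positivity),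
      ENNReal.toReal_ofReal (by positivity), ENNReal.toReal_ofReal (by positivity), tripleWeight,
      mul_assoc]
  simp only [h, Complex.real_smul, Prod.map]

lemma isTripleConvDensity_iff {p : ℝ} {f : ℝ → ℂ} {g : ℝ × ℝ → ℂ} :
    IsTripleConvDensity p f g ↔ LocallyIntegrable g volume ∧
      ∀ φ : ℝ × ℝ → ℂ, Continuous φ → HasCompactSupport φ →
        ∫ x, φ x * g x = tripleFunctional p f φ := by
  have h : ∀ φ : ℝ × ℝ → ℂ, ∫ z : (ℝ × ℝ) × (ℝ × ℝ) × (ℝ × ℝ),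
        φ (z.1 + z.2.1 + z.2.2) * (f z.1.1 * f z.2.1.1 * f z.2.2.1)
        ∂((sigmaMeasure p).prod ((sigmaMeasure p).prod (sigmaMeasure p))) =
        tripleFunctional p f φ := by
    intro φ
    rw [integral_sigmaMeasure_prod, tripleFunctional]
    refine integral_congr_ae (Eventually.of_forall fun y => ?_)
    simp only [curveSum, tensorCube, Prod.mk_add_mk]
    ring
  constructor
  · rintro ⟨h1, h2⟩
    exact ⟨h1, fun φ hφ hφ' => (h2 φ hφ hφ').trans (h φ)⟩
  · rintro ⟨h1, h2⟩
    exact ⟨h1, fun φ hφ hφ' => (h2 φ hφ hφ').trans (h φ).symm⟩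

lemma ae_tripleWeight_pos (p : ℝ) : ∀ᵐ y : ℝ × ℝ × ℝ, 0 < tripleWeight p y := by
  have h0 : ∀ᵐ x : ℝ, x ≠ 0 := Measure.ae_ne volume 0
  have h1 : ∀ᵐ y : ℝ × ℝ × ℝ, y.1 ≠ 0 := Measure.quasiMeasurePreserving_fst.ae h0
  have h2 : ∀ᵐ y : ℝ × ℝ × ℝ, y.2.1 ≠ 0 :=
    (Measure.quasiMeasurePreserving_fst.comp Measure.quasiMeasurePreserving_snd).ae h0
  have h3 : ∀ᵐ y : ℝ × ℝ × ℝ, y.2.2 ≠ 0 :=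
    (Measure.quasiMeasurePreserving_snd.comp Measure.quasiMeasurePreserving_snd).ae h0
  filter_upwards [h1, h2, h3] with y h1 h2 h3
  have := abs_pos.2 h1
  have := abs_pos.2 h2
  have := abs_pos.2 h3
  unfold tripleWeight
  positivity

/-- Functions on the plane that agree almost everywhere still do so when pulled back by the sum
of three points of the curve: the pulled back measure has a density. -/
lemma quasiMeasurePreserving_curveSum {p : ℝ} (hp : 1 < p) :
    Measure.QuasiMeasurePreserving (curveSum p) := by
  refine ⟨measurable_curveSum p, Measure.AbsolutelyContinuous.mk fun N hN h0 => ?_⟩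
  obtain ⟨C, -, hC⟩ := exists_lintegral_curveSum_le hp
  have h1 := hC (N.indicator 1) (measurable_one.indicator hN)
  rw [lintegral_indicator_one hN, h0, mul_zero, nonpos_iff_eq_zero,
    lintegral_eq_zero_iff (by measurability)] at h1
  rw [Measure.map_apply (measurable_curveSum p) hN]
  change volume {y | curveSum p y ∈ N} = 0
  rw [measure_eq_zero_iff_ae_notMem]
  filter_upwards [h1, ae_tripleWeight_pos p] with y hy hw hyN
  have hyN : curveSum p y ∈ N := hyN
  simp only [Set.indicator_of_mem hyN, Pi.one_apply, mul_one, Pi.zero_apply,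
    ENNReal.ofReal_eq_zero] at hy
  have : 0 < tripleWeight p y ^ 2 := by positivity
  linarith

lemma aestronglyMeasurable_tensorCube {f : ℝ → ℂ} (hf : AEStronglyMeasurable f volume) :
    AEStronglyMeasurable (tensorCube f) volume := by
  have h1 : AEStronglyMeasurable (fun y : ℝ × ℝ × ℝ => f y.1) volume :=
    hf.comp_quasiMeasurePreserving Measure.quasiMeasurePreserving_fst
  have h2 : AEStronglyMeasurable (fun y : ℝ × ℝ × ℝ => f y.2.1) volume :=
    hf.comp_quasiMeasurePreserving
      (Measure.quasiMeasurePreserving_fst.comp Measure.quasiMeasurePreserving_snd)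
  have h3 : AEStronglyMeasurable (fun y : ℝ × ℝ × ℝ => f y.2.2) volume :=
    hf.comp_quasiMeasurePreserving
      (Measure.quasiMeasurePreserving_snd.comp Measure.quasiMeasurePreserving_snd)
  exact (h1.mul h2).mul h3

/-- The integral over a box of a product of three functions of one variable. -/
lemma setLIntegral_prod_three {F : ℝ → ENNReal} (hF : AEMeasurable F volume) (A B D : Set ℝ) :
    ∫⁻ y in A ×ˢ B ×ˢ D, F y.1 * F y.2.1 * F y.2.2 =
      (∫⁻ x in A, F x) * (∫⁻ x in B, F x) * ∫⁻ x in D, F x := by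
  rw [Measure.volume_eq_prod, Measure.volume_eq_prod, ← Measure.prod_restrict,
    ← Measure.prod_restrict]
  simp_rw [mul_assoc]
  rw [← lintegral_prod_mul (μ := volume.restrict B) hF.restrict hF.restrict,
    ← lintegral_prod_mul hF.restrict]
  have h2 : AEMeasurable (fun y : ℝ × ℝ => F y.1)
      ((volume.restrict B).prod (volume.restrict D)) :=
    hF.restrict.comp_quasiMeasurePreserving Measure.quasiMeasurePreserving_fst
  have h3 : AEMeasurable (fun y : ℝ × ℝ => F y.2)
      ((volume.restrict B).prod (volume.restrict D)) :=
    hF.restrict.comp_quasiMeasurePreserving Measure.quasiMeasurePreserving_snd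
  exact h2.mul h3

lemma enorm_tensorCube_sq (f : ℝ → ℂ) (y : ℝ × ℝ × ℝ) :
    ‖tensorCube f y‖ₑ ^ 2 = ‖f y.1‖ₑ ^ 2 * ‖f y.2.1‖ₑ ^ 2 * ‖f y.2.2‖ₑ ^ 2 := by
  simp only [tensorCube, enorm_mul, mul_pow]

lemma lintegral_enorm_tensorCube_sq {f : ℝ → ℂ} (hf : AEStronglyMeasurable f volume) :
    ∫⁻ y, ‖tensorCube f y‖ₑ ^ 2 = eLpNorm f 2 volume ^ 6 := by
  have h := setLIntegral_prod_three (hf.enorm.pow_const 2) Set.univ Set.univ Set.univ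
  simp only [Set.univ_prod_univ, Measure.restrict_univ] at h
  simp_rw [enorm_tensorCube_sq]
  rw [h, ← eLpNorm_two_sq]
  ring

/-- The Cauchy-Schwarz inequality behind all the bounds: on a region where the triple sum of the
squared weight has density at most `C`, the integrand of `tripleFunctional` is controlled by
the `L²` norms of the test function and of the tensor cube. -/
lemma setLIntegral_enorm_sq_le {p : ℝ} {R : Set (ℝ × ℝ × ℝ)} {C : ENNReal}
    (hC : ∀ Ψ : ℝ × ℝ → ENNReal, Measurable Ψ →
      ∫⁻ y in R, ENNReal.ofReal (tripleWeight p y ^ 2) * Ψ (curveSum p y) ≤ C * ∫⁻ x, Ψ x)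
    {f : ℝ → ℂ} (hf : AEStronglyMeasurable f volume) {φ : ℝ × ℝ → ℂ} (hφ : Measurable φ) :
    (∫⁻ y in R, ‖φ (curveSum p y) * (tripleWeight p y * tensorCube f y)‖ₑ) ^ 2 ≤
      C * (∫⁻ y in R, ‖tensorCube f y‖ₑ ^ 2) * eLpNorm φ 2 volume ^ 2 := by
  have h1 : ∀ y, ‖φ (curveSum p y) * (tripleWeight p y * tensorCube f y)‖ₑ =
      (ENNReal.ofReal (tripleWeight p y) * ‖φ (curveSum p y)‖ₑ) * ‖tensorCube f y‖ₑ := by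
    intro y
    rw [enorm_mul, enorm_mul, show ‖(tripleWeight p y : ℂ)‖ₑ = ENNReal.ofReal (tripleWeight p y) by
      rw [← ofReal_norm, Complex.norm_real, Real.norm_of_nonneg (tripleWeight_nonneg p y)]]
    ring
  simp_rw [h1]
  refine (lintegral_mul_sq_le (by fun_prop)
    (aestronglyMeasurable_tensorCube hf).enorm.restrict).trans ?_
  rw [mul_right_comm]
  gcongr
  rw [eLpNorm_two_sq]
  refine le_trans (le_of_eq ?_) (hC (fun x => ‖φ x‖ₑ ^ 2) (by fun_prop))
  refine lintegral_congr fun y => ?_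
  rw [mul_pow, ENNReal.ofReal_pow (tripleWeight_nonneg p y)]

lemma exists_enorm_functional_le {p : ℝ} (hp : 1 < p) {f : ℝ → ℂ} (hf : MemLp f 2 volume) :
    ∃ B : NNReal, ∀ φ : ℝ × ℝ → ℂ, Measurable φ →
      ∫⁻ y, ‖φ (curveSum p y) * (tripleWeight p y * tensorCube f y)‖ₑ ≤
        B * eLpNorm φ 2 volume := by
  obtain ⟨C, hC, h⟩ := exists_lintegral_curveSum_le hp
  have hB : (C * eLpNorm f 2 volume ^ 6) ^ (1 / 2 : ℝ) ≠ ⊤ :=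
    ENNReal.rpow_ne_top_of_nonneg (by norm_num)
      (ENNReal.mul_ne_top hC (ENNReal.pow_ne_top hf.2.ne))
  refine ⟨((C * eLpNorm f 2 volume ^ 6) ^ (1 / 2 : ℝ)).toNNReal, fun φ hφ => ?_⟩
  rw [ENNReal.coe_toNNReal hB]
  have h1 := setLIntegral_enorm_sq_le (R := Set.univ) (C := C) (by simpa using h) hf.1 hφ
  simp only [Measure.restrict_univ] at h1
  rw [lintegral_enorm_tensorCube_sq hf.1] at h1
  rw [← ENNReal.pow_le_pow_left_iff two_ne_zero, mul_pow]
  convert h1 using 2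
  rw [← ENNReal.rpow_natCast, ← ENNReal.rpow_mul]; norm_num

lemma integrable_functional {p : ℝ} (hp : 1 < p) {f : ℝ → ℂ} (hf : MemLp f 2 volume)
    {φ : ℝ × ℝ → ℂ} (hφ : Measurable φ) (hφ2 : eLpNorm φ 2 volume ≠ ⊤) :
    Integrable fun y => φ (curveSum p y) * (tripleWeight p y * tensorCube f y) := by
  obtain ⟨B, hB⟩ := exists_enorm_functional_le hp hf
  have h1 : AEStronglyMeasurable (fun y => φ (curveSum p y)) volume :=
    (hφ.comp (measurable_curveSum p)).aestronglyMeasurable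
  have h2 : AEStronglyMeasurable (fun y => (tripleWeight p y : ℂ)) volume :=
    (Complex.measurable_ofReal.comp (measurable_tripleWeight p)).aestronglyMeasurable
  exact ⟨h1.mul (h2.mul (aestronglyMeasurable_tensorCube hf.1)),
    (hB φ hφ).trans_lt (ENNReal.mul_lt_top ENNReal.coe_lt_top hφ2.lt_top)⟩

/-- The Riesz representation theorem yields a square integrable density of the triple
convolution. -/
lemma exists_density_of_bound {p : ℝ} (hp : 1 < p) {f : ℝ → ℂ} (hf : MemLp f 2 volume) {B : NNReal}
    (hB : ∀ φ : ℝ × ℝ → ℂ, Measurable φ →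
      ∫⁻ y, ‖φ (curveSum p y) * (tripleWeight p y * tensorCube f y)‖ₑ ≤
        B * eLpNorm φ 2 volume) :
    ∃ g : ℝ × ℝ → ℂ, MemLp g 2 volume ∧ eLpNorm g 2 volume ≤ B ∧
      ∀ φ : ℝ × ℝ → ℂ, Measurable φ → MemLp φ 2 volume →
        ∫ x, φ x * g x = tripleFunctional p f φ := by
  have hq := quasiMeasurePreserving_curveSum hp
  have hintegrable : ∀ φ : Lp ℂ 2 (volume : Measure (ℝ × ℝ)), Integrable fun y =>
      φ (curveSum p y) * (tripleWeight p y * tensorCube f y) := fun φ =>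
    integrable_functional hp hf (Lp.stronglyMeasurable φ).measurable (Lp.eLpNorm_ne_top φ)
  have hcongr : ∀ {φ ψ : ℝ × ℝ → ℂ}, φ =ᵐ[volume] ψ →
      tripleFunctional p f φ = tripleFunctional p f ψ := by
    intro φ ψ h
    refine integral_congr_ae ?_
    filter_upwards [hq.ae h] with y hy
    rw [hy]
  let L₀ : Lp ℂ 2 (volume : Measure (ℝ × ℝ)) →ₗ[ℂ] ℂ :=
    { toFun := fun φ => tripleFunctional p f φ
      map_add' := fun φ ψ => by
        rw [hcongr (Lp.coeFn_add φ ψ)]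
        simp only [tripleFunctional, Pi.add_apply, add_mul]
        exact integral_add (hintegrable φ) (hintegrable ψ)
      map_smul' := fun c φ => by
        rw [hcongr (Lp.coeFn_smul c φ)]
        simp only [tripleFunctional, Pi.smul_apply, smul_eq_mul, mul_assoc, RingHom.id_apply]
        exact integral_const_mul _ _ }
  have hL₀ : ∀ φ, ‖L₀ φ‖ ≤ B * ‖φ‖ := by
    intro φ
    have h1 : ‖L₀ φ‖ₑ ≤ B * ‖φ‖ₑ := by
      rw [Lp.enorm_def]
      exact (enorm_integral_le_lintegral_enorm _).trans
        (hB φ (Lp.stronglyMeasurable φ).measurable)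
    have h2 := ENNReal.toReal_mono (ENNReal.mul_ne_top ENNReal.coe_ne_top enorm_ne_top) h1
    simpa using h2
  let L := L₀.mkContinuous B hL₀
  let g' := (InnerProductSpace.toDual ℂ (Lp ℂ 2 (volume : Measure (ℝ × ℝ)))).symm L
  have hg' : MemLp (fun x => starRingEnd ℂ (g' x)) 2 volume := (Lp.memLp g').star
  have hnorm : eLpNorm (fun x => starRingEnd ℂ (g' x)) 2 volume = ‖g'‖ₑ := by
    rw [Lp.enorm_def]
    exact eLpNorm_congr_norm_ae (Eventually.of_forall fun x => by simp)
  refine ⟨fun x => starRingEnd ℂ (g' x), hg', ?_, fun φ hφ hφ2 => ?_⟩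
  · rw [hnorm]
    have : ‖g'‖ ≤ B := by
      rw [LinearIsometryEquiv.norm_map]
      exact L₀.mkContinuous_norm_le B.2 hL₀
    rw [← ofReal_norm]
    exact ENNReal.ofReal_le_of_le_toReal (by simpa using this)
  · have h1 : inner ℂ g' (hφ2.toLp φ) = L (hφ2.toLp φ) := InnerProductSpace.toDual_symm_apply
    rw [L2.inner_def] at h1
    have h2 : L (hφ2.toLp φ) = tripleFunctional p f φ := hcongr hφ2.coeFn_toLp
    rw [← h2, ← h1]
    refine integral_congr_ae ?_
    filter_upwards [hφ2.coeFn_toLp] with x hx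
    rw [hx]
    simp

lemma isTripleConvDensity_of_forall {p : ℝ} {f : ℝ → ℂ} {g : ℝ × ℝ → ℂ} (hg : MemLp g 2 volume)
    (h : ∀ φ : ℝ × ℝ → ℂ, Measurable φ → MemLp φ 2 volume →
        ∫ x, φ x * g x = tripleFunctional p f φ) : IsTripleConvDensity p f g :=
  isTripleConvDensity_iff.2 ⟨hg.locallyIntegrable (by norm_num), fun φ hφ hφ' =>
    h φ hφ.measurable (hφ.memLp_of_hasCompactSupport hφ')⟩

lemma IsTripleConvDensity.ae_eq {p : ℝ} {f : ℝ → ℂ} {g g' : ℝ × ℝ → ℂ}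
    (h : IsTripleConvDensity p f g) (h' : IsTripleConvDensity p f g') : g =ᵐ[volume] g' := by
  refine ae_eq_of_integral_contDiff_smul_eq h.locallyIntegrable h'.locallyIntegrable
    fun φ hφ hφ' => ?_
  have hc : Continuous fun x => (φ x : ℂ) := Complex.continuous_ofReal.comp hφ.continuous
  have hs : HasCompactSupport fun x => (φ x : ℂ) := hφ'.comp_left Complex.ofReal_zero
  have e := (h.integral_eq _ hc hs).trans (h'.integral_eq _ hc hs).symm
  simpa only [Complex.real_smul] using e

lemma tripleConvNorm_le {p : ℝ} (hp : 1 < p) {f : ℝ → ℂ} (hf : MemLp f 2 volume) {B : ENNReal}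
    (hB : ∀ φ : ℝ × ℝ → ℂ, Measurable φ →
      ∫⁻ y, ‖φ (curveSum p y) * (tripleWeight p y * tensorCube f y)‖ₑ ≤
        B * eLpNorm φ 2 volume) : tripleConvNorm p f ≤ B := by
  rcases eq_or_ne B ⊤ with rfl | hBt
  · exact le_top
  lift B to NNReal using hBt
  obtain ⟨g, hg, hgB, h⟩ := exists_density_of_bound hp hf hB
  exact (iInf₂_le g (isTripleConvDensity_of_forall hg h)).trans hgB

/-- The norm of the triple convolution bounds the functional on `L²(ℝ²)`, because all densities
agree almost everywhere with the one given by the Riesz representation theorem. -/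
lemma enorm_tripleFunctional_le {p : ℝ} (hp : 1 < p) {f : ℝ → ℂ} (hf : MemLp f 2 volume)
    {φ : ℝ × ℝ → ℂ} (hφ : Measurable φ) (hφ2 : MemLp φ 2 volume) :
    ‖tripleFunctional p f φ‖ₑ ^ 2 ≤ tripleConvNorm p f ^ 2 * eLpNorm φ 2 volume ^ 2 := by
  obtain ⟨B, hB⟩ := exists_enorm_functional_le hp hf
  obtain ⟨g, hg, -, h⟩ := exists_density_of_bound hp hf hB
  have hnorm : tripleConvNorm p f = eLpNorm g 2 volume := by
    refine le_antisymm (iInf₂_le g (isTripleConvDensity_of_forall hg h))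
      (le_iInf₂ fun g' hg' => ?_)
    exact (eLpNorm_congr_ae ((isTripleConvDensity_of_forall hg h).ae_eq hg')).le
  rw [hnorm, ← h φ hφ hφ2, mul_comm, eLpNorm_two_sq, eLpNorm_two_sq]
  refine le_trans (pow_le_pow_left' (enorm_integral_le_lintegral_enorm _) 2) ?_
  simp_rw [enorm_mul]
  exact lintegral_mul_sq_le hφ.enorm.aemeasurable hg.1.enorm

/-! ### The upper bound for concentrating sequences -/

/-- The factor by which the density of the triple sum may differ from its limiting value when the
weight varies by a relative error `ε`. -/
noncomputable def distortion (ε : ℝ) : ℝ := ((1 + ε) / (1 - ε)) ^ 6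

/-- The limiting value of the density of the triple sum of the squared weight along the diagonal. -/
noncomputable def diagConst (p : ℝ) : ℝ := 2 * Real.pi / (Real.sqrt 3 * p * (p - 1))

/-- An interval on which the weight is constant up to a relative error `ε`. -/
structure IsWindow (p ε : ℝ) (U : Set ℝ) (w : ℝ) : Prop where
  ordConnected : U.OrdConnected
  ne_zero : ∀ x ∈ U, x ≠ 0
  pos : 0 < w
  mem : ∀ x ∈ U, |x| ^ ((p - 2) / 6) ∈ Set.Icc ((1 - ε) * w) ((1 + ε) * w)

lemma exists_isWindow (p : ℝ) {y₀ ε : ℝ} (hy₀ : y₀ ≠ 0) (hε : 0 < ε) :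
    ∃ δ > 0, IsWindow p ε (Metric.ball y₀ δ) (|y₀| ^ ((p - 2) / 6)) := by
  have hw : 0 < |y₀| ^ ((p - 2) / 6) := Real.rpow_pos_of_pos (abs_pos.2 hy₀) _
  have hc : ContinuousAt (fun x : ℝ => |x| ^ ((p - 2) / 6)) y₀ :=
    continuous_abs.continuousAt.rpow_const (Or.inl (abs_ne_zero.2 hy₀))
  have h1 : ∀ᶠ x in nhds y₀, |x| ^ ((p - 2) / 6) ∈
      Set.Icc ((1 - ε) * |y₀| ^ ((p - 2) / 6)) ((1 + ε) * |y₀| ^ ((p - 2) / 6)) :=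
    hc.eventually (Icc_mem_nhds (by nlinarith) (by nlinarith))
  obtain ⟨δ, hδ, h⟩ := Metric.eventually_nhds_iff_ball.1 (h1.and (eventually_ne_nhds hy₀))
  refine ⟨δ, hδ, ?_, fun x hx => (h x hx).2, hw, fun x hx => (h x hx).1⟩
  rw [Real.ball_eq_Ioo]
  exact Set.ordConnected_Ioo

namespace IsWindow

variable {p ε w : ℝ} {U : Set ℝ}

lemma abs_rpow_mem (h : IsWindow p ε U w) (hε : ε < 1) {x : ℝ} (hx : x ∈ U) :
    |x| ^ (p - 2) ∈ Set.Icc (((1 - ε) * w) ^ 6) (((1 + ε) * w) ^ 6) := by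
  have h1 := h.mem x hx
  have h2 : |x| ^ (p - 2) = (|x| ^ ((p - 2) / 6)) ^ 6 := by
    rw [← Real.rpow_natCast, ← Real.rpow_mul (abs_nonneg _)]; congr 1; push_cast; ring
  have h3 : 0 ≤ (1 - ε) * w := mul_nonneg (by linarith) h.pos.le
  rw [h2]
  exact ⟨pow_le_pow_left₀ h3 h1.1 6, pow_le_pow_left₀ (h3.trans h1.1) h1.2 6⟩

lemma tripleWeight_sq_mem (h : IsWindow p ε U w) (hε : ε < 1) {y : ℝ × ℝ × ℝ}
    (hy : y ∈ U ×ˢ U ×ˢ U) :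
    tripleWeight p y ^ 2 ∈ Set.Icc (((1 - ε) * w) ^ 6) (((1 + ε) * w) ^ 6) := by
  obtain ⟨a1, b1⟩ := h.mem _ hy.1
  obtain ⟨a2, b2⟩ := h.mem _ hy.2.1
  obtain ⟨a3, b3⟩ := h.mem _ hy.2.2
  have h3 : 0 ≤ (1 - ε) * w := mul_nonneg (by linarith) h.pos.le
  have h4 : 0 ≤ (1 + ε) * w := h3.trans (a1.trans b1)
  constructor
  · calc ((1 - ε) * w) ^ 6 = ((1 - ε) * w * ((1 - ε) * w) * ((1 - ε) * w)) ^ 2 := by ring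
      _ ≤ _ := by unfold tripleWeight; gcongr
  · calc tripleWeight p y ^ 2 ≤ ((1 + ε) * w * ((1 + ε) * w) * ((1 + ε) * w)) ^ 2 := by
          unfold tripleWeight; gcongr
      _ = _ := by ring

lemma powGap_mem (h : IsWindow p ε U w) (hp : 1 < p) (hε : ε < 1) {y : ℝ × ℝ × ℝ}
    (hy : y ∈ U ×ˢ U ×ˢ U) :
    powGap p y ∈ Set.Icc ((p - 1) * ((1 - ε) * w) ^ 6 * sqGap y)
      ((p - 1) * ((1 + ε) * w) ^ 6 * sqGap y) := by
  have key := fun {a b : ℝ} (ha : a ∈ U) (hb : b ∈ U) => oddPow_sub_mul_sub_mem (p := p)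
    h.ordConnected hp h.ne_zero (fun x hx => h.abs_rpow_mem hε hx) ha hb
  have k1 := key hy.1 hy.2.1
  have k2 := key hy.1 hy.2.2
  have k3 := key hy.2.1 hy.2.2
  simp only [powGap, sqGap]
  constructor <;> linarith [k1.1, k1.2, k2.1, k2.2, k3.1, k3.2]

/-- Near the diagonal point the triple sum of the squared weight has density at most
`distortion ε * diagConst p`. -/
lemma setLIntegral_le (h : IsWindow p ε U w) (hU : MeasurableSet U) (hp : 1 < p) (hε0 : 0 < ε)
    (hε : ε < 1) {Ψ : ℝ × ℝ → ENNReal} (hΨ : Measurable Ψ) :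
    ∫⁻ y in U ×ˢ U ×ˢ U, ENNReal.ofReal (tripleWeight p y ^ 2) * Ψ (curveSum p y) ≤
      ENNReal.ofReal (distortion ε * diagConst p) * ∫⁻ x, Ψ x := by
  have hε1 : 0 < 1 - ε := by linarith
  have hp1 : 0 < p - 1 := by linarith
  have hp0 : 0 < p := by linarith
  have hw := h.pos
  have := setLIntegral_curveSum_le_of_angle hp (hU.prod (hU.prod hU))
    (k := fun _ => ENNReal.ofReal (distortion ε / (p * (p - 1)))) measurable_const
    (fun ξ θ r _ hy => by
      rw [← ENNReal.ofReal_mul (by unfold distortion; positivity)]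
      refine ENNReal.ofReal_le_ofReal ?_
      have h1 := (h.tripleWeight_sq_mem hε hy).2
      have h2 := (h.powGap_mem hp hε hy).1
      have h3 := sqGap_nonneg (cylPoint ξ θ r)
      calc _ ≤ ((1 + ε) * w) ^ 6 * sqGap (cylPoint ξ θ r) := by gcongr
        _ = distortion ε / (p * (p - 1)) *
            (p * ((p - 1) * ((1 - ε) * w) ^ 6 * sqGap (cylPoint ξ θ r))) := by
            unfold distortion; field_simp
        _ ≤ _ := by unfold distortion; gcongr) hΨ
  refine this.trans (le_of_eq ?_)
  congr 1
  rw [lintegral_const, Measure.restrict_apply_univ, Real.volume_Ioo,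
    ← ENNReal.ofReal_mul (by unfold distortion; positivity), ← ENNReal.ofReal_mul (by positivity)]
  congr 1
  unfold diagConst
  field_simp
  ring

end IsWindow

lemma lintegral_compl_tensorCube_le {f : ℝ → ℂ} (hf : AEStronglyMeasurable f volume) (U : Set ℝ) :
    ∫⁻ y in (U ×ˢ U ×ˢ U)ᶜ, ‖tensorCube f y‖ₑ ^ 2 ≤
      3 * (∫⁻ x in Uᶜ, ‖f x‖ₑ ^ 2) * eLpNorm f 2 volume ^ 4 := by
  have hsub : (U ×ˢ U ×ˢ U)ᶜ ⊆ (Uᶜ ×ˢ Set.univ ×ˢ Set.univ ∪ Set.univ ×ˢ Uᶜ ×ˢ Set.univ) ∪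
      (Set.univ ×ˢ Set.univ ×ˢ Uᶜ : Set (ℝ × ℝ × ℝ)) := by
    intro y hy
    simp only [Set.mem_compl_iff, Set.mem_prod, Set.mem_union, Set.mem_univ] at *
    tauto
  simp_rw [enorm_tensorCube_sq]
  refine (lintegral_mono_set hsub).trans ((lintegral_union_le _ _ _).trans
    ((add_le_add (lintegral_union_le _ _ _) le_rfl).trans (le_of_eq ?_)))
  have h := setLIntegral_prod_three (hf.enorm.pow_const 2)
  rw [h, h, h]
  simp only [Measure.restrict_univ]
  rw [← eLpNorm_two_sq (μ := volume)]
  ring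

/-- If the mass of `f` outside of a window is at most the fraction `η²` of its total mass, then the
convolution quotient exceeds the local density bound only by a term of order `η`. -/
lemma IsWindow.convRatio_le {p ε w : ℝ} {U : Set ℝ} (h : IsWindow p ε U w) (hU : MeasurableSet U)
    (hp : 1 < p) (hε0 : 0 < ε) (hε : ε < 1) {C : ENNReal}
    (hC : ∀ Ψ : ℝ × ℝ → ENNReal, Measurable Ψ →
      ∫⁻ y, ENNReal.ofReal (tripleWeight p y ^ 2) * Ψ (curveSum p y) ≤ C * ∫⁻ x, Ψ x)
    {f : ℝ → ℂ} (hf : MemLp f 2 volume) {η : ENNReal}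
    (hη : ∫⁻ x in Uᶜ, ‖f x‖ₑ ^ 2 ≤ η ^ 2 * ∫⁻ x, ‖f x‖ₑ ^ 2) :
    convRatio p f ≤ (ENNReal.ofReal (distortion ε * diagConst p) ^ (1 / 2 : ℝ) +
      (3 * C) ^ (1 / 2 : ℝ) * η) ^ 2 := by
  set D := ENNReal.ofReal (distortion ε * diagConst p) with hD
  set n := eLpNorm f 2 volume with hn
  have hsq : ∀ a : ENNReal, (a ^ (1 / 2 : ℝ)) ^ 2 = a := fun a => by
    rw [← ENNReal.rpow_natCast, ← ENNReal.rpow_mul]; norm_num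
  rw [← eLpNorm_two_sq (μ := volume), ← hn] at hη
  have hT : tripleConvNorm p f ≤ (D ^ (1 / 2 : ℝ) + (3 * C) ^ (1 / 2 : ℝ) * η) * n ^ 3 := by
    refine tripleConvNorm_le hp hf fun φ hφ => ?_
    rw [← lintegral_add_compl _ (hU.prod (hU.prod hU)), add_mul, add_mul]
    refine add_le_add ?_ ?_
    · rw [← ENNReal.pow_le_pow_left_iff two_ne_zero, mul_pow, mul_pow, hsq]
      refine (setLIntegral_enorm_sq_le (fun Ψ hΨ => h.setLIntegral_le hU hp hε0 hε hΨ) hf.1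
        hφ).trans ?_
      gcongr
      calc _ ≤ ∫⁻ y, ‖tensorCube f y‖ₑ ^ 2 := setLIntegral_le_lintegral _ _
        _ = (n ^ 3) ^ 2 := by rw [lintegral_enorm_tensorCube_sq hf.1]; ring
    · rw [← ENNReal.pow_le_pow_left_iff two_ne_zero, mul_pow, mul_pow, mul_pow, hsq]
      refine (setLIntegral_enorm_sq_le (C := C) (fun Ψ hΨ =>
        (setLIntegral_le_lintegral _ _).trans (hC Ψ hΨ)) hf.1 hφ).trans
        (mul_le_mul' ?_ le_rfl)
      calc _ ≤ C * (3 * (η ^ 2 * n ^ 2) * n ^ 4) := by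
            gcongr
            exact (lintegral_compl_tensorCube_le hf.1 U).trans (by gcongr)
        _ = _ := by ring
  refine ENNReal.div_le_of_le_mul ?_
  calc _ ≤ ((D ^ (1 / 2 : ℝ) + (3 * C) ^ (1 / 2 : ℝ) * η) * n ^ 3) ^ 2 := by gcongr
    _ = _ := by ring

lemma ofReal_integral_norm_sq {f : ℝ → ℂ} (hf : MemLp f 2 volume) (S : Set ℝ) :
    ENNReal.ofReal (∫ y in S, ‖f y‖ ^ 2) = ∫⁻ y in S, ‖f y‖ₑ ^ 2 := by
  have hi : Integrable (fun y => ‖f y‖ ^ 2) volume :=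
    (memLp_two_iff_integrable_sq_norm hf.1).1 hf
  rw [ofReal_integral_eq_lintegral_ofReal hi.integrableOn
    (Eventually.of_forall fun y => by positivity)]
  refine lintegral_congr fun y => ?_
  rw [ENNReal.ofReal_pow (norm_nonneg _), ofReal_norm]

lemma ConcentratesAt.eventually_lintegral_le {f : ℕ → ℝ → ℂ} {y₀ : ℝ} (hf : ConcentratesAt f y₀)
    {ε ρ : ℝ} (hε : 0 < ε) (hρ : 0 < ρ) : ∀ᶠ n in atTop,
      ∫⁻ x in (Metric.ball y₀ ρ)ᶜ, ‖f n x‖ₑ ^ 2 ≤ ENNReal.ofReal ε * ∫⁻ x, ‖f n x‖ₑ ^ 2 := by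
  obtain ⟨N, hN⟩ := hf.concentrates ε hε ρ hρ
  filter_upwards [eventually_ge_atTop N] with n hn
  have h1 := hN n hn
  have hset : {y : ℝ | ρ ≤ |y - y₀|} = (Metric.ball y₀ ρ)ᶜ := by
    ext y; simp [Real.dist_eq]
  rw [hset] at h1
  have h2 := ofReal_integral_norm_sq (hf.memLp n) Set.univ
  simp only [Measure.restrict_univ] at h2
  rw [← ofReal_integral_norm_sq (hf.memLp n), ← h2, ← ENNReal.ofReal_mul hε.le]
  exact ENNReal.ofReal_le_ofReal h1.le

lemma diagConst_pos {p : ℝ} (hp : 1 < p) : 0 < diagConst p := by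
  have : 0 < p - 1 := by linarith
  have : 0 < p := by linarith
  have := Real.pi_pos
  unfold diagConst
  positivity

lemma continuousAt_distortion : ContinuousAt distortion 0 := by
  unfold distortion
  exact ((continuousAt_const.add continuousAt_id).div (continuousAt_const.sub continuousAt_id)
    (by simp)).pow 6

lemma distortion_zero : distortion 0 = 1 := by simp [distortion]

/-- The upper bound: first the mass far from `y₀` tends to zero, then the window shrinks. -/
theorem limsup_convRatio_le {p : ℝ} (hp : 1 < p) {y₀ : ℝ} (hy₀ : y₀ ≠ 0) {f : ℕ → ℝ → ℂ}
    (hf : ConcentratesAt f y₀) :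
    limsup (fun n => convRatio p (f n)) atTop ≤ ENNReal.ofReal (diagConst p) := by
  obtain ⟨C, hCt, hC⟩ := exists_lintegral_curveSum_le hp
  have hsq : ∀ a : ENNReal, (a ^ (1 / 2 : ℝ)) ^ 2 = a := fun a => by
    rw [← ENNReal.rpow_natCast, ← ENNReal.rpow_mul]; norm_num
  set L := limsup (fun n => convRatio p (f n)) atTop with hL
  have h1 : ∀ ε ∈ Set.Ioo (0 : ℝ) 1, ∀ η > (0 : ℝ), L ≤
      (ENNReal.ofReal (distortion ε * diagConst p) ^ (1 / 2 : ℝ) +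
      (3 * C) ^ (1 / 2 : ℝ) * ENNReal.ofReal η) ^ 2 := by
    intro ε hε η hη
    obtain ⟨δ, hδ, hW⟩ := exists_isWindow p hy₀ hε.1
    refine limsup_le_of_le (by isBoundedDefault) ?_
    filter_upwards [hf.eventually_lintegral_le (sq_pos_of_pos hη) hδ] with n hn
    refine hW.convRatio_le Metric.isOpen_ball.measurableSet hp hε.1 hε.2 hC (hf.memLp n) ?_
    rwa [← ENNReal.ofReal_pow hη.le]
  have h2 : ∀ ε ∈ Set.Ioo (0 : ℝ) 1, L ≤ ENNReal.ofReal (distortion ε * diagConst p) := by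
    intro ε hε
    have ht : Tendsto (fun η : ℝ => (ENNReal.ofReal (distortion ε * diagConst p) ^ (1 / 2 : ℝ) +
        (3 * C) ^ (1 / 2 : ℝ) * ENNReal.ofReal η) ^ 2) (nhdsWithin 0 (Set.Ioi 0))
        (nhds (ENNReal.ofReal (distortion ε * diagConst p))) := by
      have h0 : Tendsto ENNReal.ofReal (nhdsWithin (0 : ℝ) (Set.Ioi 0)) (nhds 0) := by
        simpa using (ENNReal.tendsto_ofReal tendsto_id (a := (0 : ℝ))).mono_left nhdsWithin_le_nhds
      have h3C : (3 * C) ^ (1 / 2 : ℝ) ≠ ⊤ :=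
        ENNReal.rpow_ne_top_of_nonneg (by norm_num) (ENNReal.mul_ne_top (by simp) hCt)
      have := ENNReal.Tendsto.pow (n := 2) ((ENNReal.Tendsto.const_mul h0 (Or.inr h3C)).const_add
        (ENNReal.ofReal (distortion ε * diagConst p) ^ (1 / 2 : ℝ)))
      simpa only [mul_zero, add_zero, hsq] using this
    refine ge_of_tendsto ht ?_
    filter_upwards [self_mem_nhdsWithin] with η hη
    exact h1 ε hε η hη
  have ht : Tendsto (fun ε : ℝ => ENNReal.ofReal (distortion ε * diagConst p))
      (nhdsWithin 0 (Set.Ioi 0)) (nhds (ENNReal.ofReal (diagConst p))) := by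
    have := ENNReal.tendsto_ofReal (continuousAt_distortion.tendsto.mul_const (diagConst p))
    rw [distortion_zero, one_mul] at this
    exact this.mono_left nhdsWithin_le_nhds
  refine ge_of_tendsto ht ?_
  filter_upwards [Ioo_mem_nhdsGT (show (0 : ℝ) < 1 by norm_num)] with ε hε
  exact h2 ε hε

/-! ### The trial functions -/

/-- The amount by which `|y|^p` exceeds its tangent line at `y₀`. -/
noncomputable def tangentGap (p y₀ y : ℝ) : ℝ := |y| ^ p - |y₀| ^ p - p * oddPow p y₀ * (y - y₀)

lemma hasDerivAt_tangentGap {p : ℝ} (hp : 1 < p) (y₀ y : ℝ) :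
    HasDerivAt (tangentGap p y₀) (p * (oddPow p y - oddPow p y₀)) y := by
  have h := ((hasDerivAt_abs_rpow_oddPow hp y).sub_const (|y₀| ^ p)).sub
    (((hasDerivAt_id y).sub_const y₀).const_mul (p * oddPow p y₀))
  refine h.congr_deriv ?_
  ring

lemma tangentGap_self (p y₀ : ℝ) : tangentGap p y₀ y₀ = 0 := by simp [tangentGap]

lemma continuous_tangentGap {p : ℝ} (hp : 1 < p) (y₀ : ℝ) : Continuous (tangentGap p y₀) :=
  continuous_iff_continuousAt.2 fun y => (hasDerivAt_tangentGap hp y₀ y).continuousAt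

lemma tangentGap_strictMonoOn {p : ℝ} (hp : 1 < p) (y₀ : ℝ) :
    StrictMonoOn (tangentGap p y₀) (Set.Ici y₀) := by
  refine strictMonoOn_of_deriv_pos (convex_Ici _) (continuous_tangentGap hp y₀).continuousOn
    fun c hc => ?_
  rw [interior_Ici, Set.mem_Ioi] at hc
  rw [(hasDerivAt_tangentGap hp y₀ c).deriv]
  exact mul_pos (by linarith) (sub_pos.2 (oddPow_strictMono hp hc))

lemma tangentGap_strictAntiOn {p : ℝ} (hp : 1 < p) (y₀ : ℝ) :
    StrictAntiOn (tangentGap p y₀) (Set.Iic y₀) := by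
  refine strictAntiOn_of_deriv_neg (convex_Iic _) (continuous_tangentGap hp y₀).continuousOn
    fun c hc => ?_
  rw [interior_Iic, Set.mem_Iio] at hc
  rw [(hasDerivAt_tangentGap hp y₀ c).deriv]
  exact mul_neg_of_pos_of_neg (by linarith) (sub_neg.2 (oddPow_strictMono hp hc))

/-- Away from `y₀` the gap is bounded below by a positive constant. -/
lemma exists_tangentGap_ge {p : ℝ} (hp : 1 < p) (y₀ : ℝ) {ρ : ℝ} (hρ : 0 < ρ) :
    ∃ c > 0, ∀ y, ρ ≤ |y - y₀| → c ≤ tangentGap p y₀ y := by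
  have hm := tangentGap_strictMonoOn hp y₀
  have ha := tangentGap_strictAntiOn hp y₀
  have h1 : 0 < tangentGap p y₀ (y₀ + ρ) := by
    rw [← tangentGap_self p y₀]
    exact hm (Set.mem_Ici.2 le_rfl) (Set.mem_Ici.2 (by linarith)) (by linarith)
  have h2 : 0 < tangentGap p y₀ (y₀ - ρ) := by
    rw [← tangentGap_self p y₀]
    exact ha (Set.mem_Iic.2 (by linarith)) (Set.mem_Iic.2 le_rfl) (by linarith)
  refine ⟨_, lt_min h1 h2, fun y hy => ?_⟩
  rcases le_abs'.1 hy with h | h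
  · refine (min_le_right _ _).trans (ha.antitoneOn ?_ ?_ ?_) <;> (try simp only [Set.mem_Iic]) <;>
      linarith
  · refine (min_le_left _ _).trans (hm.monotoneOn ?_ ?_ ?_) <;> (try simp only [Set.mem_Ici]) <;>
      linarith

lemma tangentGap_nonneg {p : ℝ} (hp : 1 < p) (y₀ y : ℝ) : 0 ≤ tangentGap p y₀ y := by
  rcases eq_or_ne y y₀ with rfl | h
  · rw [tangentGap_self]
  · obtain ⟨c, hc, hcy⟩ := exists_tangentGap_ge hp y₀ (abs_pos.2 (sub_ne_zero.2 h))
    exact hc.le.trans (hcy y le_rfl)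

/-- The gap grows like `|y|^p`, by Young's inequality. -/
lemma exists_tangentGap_ge_rpow {p : ℝ} (hp : 1 < p) (y₀ : ℝ) :
    ∃ C, ∀ y, (1 - 1 / p) * |y| ^ p - C ≤ tangentGap p y₀ y := by
  have hpq := Real.HolderConjugate.conjExponent hp
  refine ⟨|p * oddPow p y₀| ^ p.conjExponent / p.conjExponent + |y₀| ^ p - p * oddPow p y₀ * y₀,
    fun y => ?_⟩
  have h := Real.young_inequality y (p * oddPow p y₀) hpq
  unfold tangentGap
  have e : (1 - 1 / p) * |y| ^ p = |y| ^ p - |y| ^ p / p := by ring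
  rw [e]
  linarith

lemma trialFunction_eq (p y₀ : ℝ) (n : ℕ) (y : ℝ) : trialFunction p y₀ n y =
    ((Real.exp (-(n : ℝ) * tangentGap p y₀ y) * |y| ^ ((p - 2) / 6) : ℝ) : ℂ) := by
  unfold trialFunction tangentGap oddPow
  congr 4
  ring

lemma norm_trialFunction_sq (p y₀ : ℝ) (n : ℕ) (y : ℝ) : ‖trialFunction p y₀ n y‖ ^ 2 =
    Real.exp (-(2 * n) * tangentGap p y₀ y) * |y| ^ ((p - 2) / 3) := by
  rw [trialFunction_eq, Complex.norm_real, Real.norm_of_nonneg (by positivity), mul_pow,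
    ← Real.exp_nat_mul, ← Real.rpow_natCast (|y| ^ _), ← Real.rpow_mul (abs_nonneg _)]
  congr 2 <;> push_cast <;> ring

lemma measurable_trialFunction {p : ℝ} (hp : 1 < p) (y₀ : ℝ) (n : ℕ) :
    Measurable (trialFunction p y₀ n) := by
  have h : Measurable (tangentGap p y₀) := (continuous_tangentGap hp y₀).measurable
  rw [funext (trialFunction_eq p y₀ n)]
  fun_prop

lemma integrable_abs_rpow_mul_exp {p s b : ℝ} (hp : 0 < p) (hs : -1 < s) (hb : 0 < b) :
    Integrable fun y : ℝ => |y| ^ s * Real.exp (-b * |y| ^ p) := by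
  refine Integrable.of_integral_ne_zero ?_
  rw [integral_comp_abs (f := fun y => y ^ s * Real.exp (-b * y ^ p)),
    integral_rpow_mul_exp_neg_mul_rpow hp hs hb]
  have : 0 < Real.Gamma ((s + 1) / p) := Real.Gamma_pos_of_pos (div_pos (by linarith) hp)
  positivity

lemma memLp_trialFunction {p : ℝ} (hp : 1 < p) (y₀ : ℝ) {n : ℕ} (hn : 1 ≤ n) :
    MemLp (trialFunction p y₀ n) 2 volume := by
  have hm := measurable_trialFunction hp y₀ n
  refine (memLp_two_iff_integrable_sq_norm hm.aestronglyMeasurable).2 ?_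
  obtain ⟨C, hC⟩ := exists_tangentGap_ge_rpow hp y₀
  have hp1 : 0 < 1 - 1 / p := by
    rw [sub_pos, div_lt_one (by linarith)]; exact hp
  have hn' : (1 : ℝ) ≤ n := by exact_mod_cast hn
  refine ((integrable_abs_rpow_mul_exp (s := (p - 2) / 3) (b := 2 * (1 - 1 / p))
    (show 0 < p by linarith) (by linarith) (by positivity)).const_mul (Real.exp (2 * C))).mono'
    (by fun_prop) (Eventually.of_forall fun y => ?_)
  rw [Real.norm_of_nonneg (by positivity), norm_trialFunction_sq]
  have h1 := tangentGap_nonneg hp y₀ y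
  have h2 : Real.exp (-(2 * n) * tangentGap p y₀ y) ≤
      Real.exp (2 * C) * Real.exp (-(2 * (1 - 1 / p)) * |y| ^ p) := by
    rw [← Real.exp_add]
    refine Real.exp_le_exp.2 ?_
    nlinarith [hC y]
  calc _ ≤ Real.exp (2 * C) * Real.exp (-(2 * (1 - 1 / p)) * |y| ^ p) * |y| ^ ((p - 2) / 3) := by
        gcongr
    _ = _ := by ring

lemma integrable_norm_trialFunction_sq {p : ℝ} (hp : 1 < p) (y₀ : ℝ) {n : ℕ} (hn : 1 ≤ n) :
    Integrable fun y => ‖trialFunction p y₀ n y‖ ^ 2 :=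
  (memLp_two_iff_integrable_sq_norm (measurable_trialFunction hp y₀ n).aestronglyMeasurable).1
    (memLp_trialFunction hp y₀ hn)

lemma norm_trialFunction_sq_pos (p y₀ : ℝ) (n : ℕ) {y : ℝ} (hy : y ≠ 0) :
    0 < ‖trialFunction p y₀ n y‖ ^ 2 := by
  rw [norm_trialFunction_sq]
  have := abs_pos.2 hy
  positivity

lemma setIntegral_norm_trialFunction_sq_pos {p : ℝ} (hp : 1 < p) (y₀ : ℝ) {n : ℕ} (hn : 1 ≤ n)
    {ρ : ℝ} (hρ : 0 < ρ) : 0 < ∫ y in Metric.ball y₀ ρ, ‖trialFunction p y₀ n y‖ ^ 2 := by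
  rw [setIntegral_pos_iff_support_of_nonneg_ae (Eventually.of_forall fun y => by positivity)
    (integrable_norm_trialFunction_sq hp y₀ hn).integrableOn]
  have hsub : Metric.ball y₀ ρ \ {0} ⊆
      (Function.support fun y => ‖trialFunction p y₀ n y‖ ^ 2) ∩ Metric.ball y₀ ρ := fun y hy =>
    ⟨(norm_trialFunction_sq_pos p y₀ n hy.2).ne', hy.1⟩
  refine lt_of_lt_of_le ?_ (measure_mono hsub)
  rw [measure_sdiff_null (by simp)]
  exact Metric.measure_ball_pos _ _ hρ

lemma eLpNorm_trialFunction_ne_zero {p : ℝ} (hp : 1 < p) (y₀ : ℝ) {n : ℕ} (hn : 1 ≤ n) :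
    eLpNorm (trialFunction p y₀ n) 2 volume ≠ 0 := by
  intro h
  rw [eLpNorm_eq_zero_iff (measurable_trialFunction hp y₀ n).aestronglyMeasurable (by norm_num)] at h
  have h1 := setIntegral_norm_trialFunction_sq_pos hp y₀ hn one_pos
  have h2 : ∫ y in Metric.ball y₀ 1, ‖trialFunction p y₀ n y‖ ^ 2 = 0 := by
    refine (integral_congr_ae (ae_restrict_of_ae (h.mono fun y hy => ?_))).trans
      (integral_zero _ _)
    simp [hy]
  linarith

/-- Laplace's principle: the mass of the trial functions concentrates at `y₀`, where the exponent
is largest. -/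
lemma concentratesAt_trialFunction {p : ℝ} (hp : 1 < p) (y₀ : ℝ) :
    ConcentratesAt (fun n => trialFunction p y₀ (n + 1)) y₀ := by
  refine ⟨fun n => memLp_trialFunction hp y₀ (by omega), fun ε hε ρ hρ => ?_⟩
  obtain ⟨c, hc, hout⟩ := exists_tangentGap_ge hp y₀ hρ
  obtain ⟨r, hr, hin⟩ : ∃ r > 0, ∀ y ∈ Metric.ball y₀ r, tangentGap p y₀ y < c / 2 := by
    refine Metric.eventually_nhds_iff_ball.1
      ((continuous_tangentGap hp y₀).continuousAt.eventually (gt_mem_nhds ?_))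
    rw [tangentGap_self]; positivity
  set I := ∫ y, ‖trialFunction p y₀ 1 y‖ ^ 2 with hI
  set K := ∫ y in Metric.ball y₀ r, ‖trialFunction p y₀ 1 y‖ ^ 2 with hK
  have hK0 : 0 < K := setIntegral_norm_trialFunction_sq_pos hp y₀ le_rfl hr
  have hi1 := integrable_norm_trialFunction_sq hp y₀ (n := 1) le_rfl
  have hstep : ∀ (n : ℕ) (y : ℝ), ‖trialFunction p y₀ (n + 1) y‖ ^ 2 =
      Real.exp (-(2 * n) * tangentGap p y₀ y) * ‖trialFunction p y₀ 1 y‖ ^ 2 := by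
    intro n y
    rw [norm_trialFunction_sq, norm_trialFunction_sq, ← mul_assoc, ← Real.exp_add]
    congr 2
    push_cast; ring
  have hS : MeasurableSet {y : ℝ | ρ ≤ |y - y₀|} := measurableSet_le (by fun_prop) (by fun_prop)
  have hupper : ∀ n : ℕ, ∫ y in {y : ℝ | ρ ≤ |y - y₀|}, ‖trialFunction p y₀ (n + 1) y‖ ^ 2 ≤
      Real.exp (-(2 * n) * c) * I := by
    intro n
    calc _ ≤ ∫ y in {y : ℝ | ρ ≤ |y - y₀|}, Real.exp (-(2 * n) * c) *
          ‖trialFunction p y₀ 1 y‖ ^ 2 := by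
          refine setIntegral_mono_on
            (integrable_norm_trialFunction_sq hp y₀ (by omega)).integrableOn
            (hi1.const_mul _).integrableOn hS fun y hy => ?_
          rw [hstep n y]
          have h1 := hout y hy
          have h2 : (0 : ℝ) ≤ n := n.cast_nonneg
          gcongr ?_ * _
          exact Real.exp_le_exp.2 (by nlinarith)
      _ ≤ ∫ y, Real.exp (-(2 * n) * c) * ‖trialFunction p y₀ 1 y‖ ^ 2 :=
          setIntegral_le_integral (hi1.const_mul _) (Eventually.of_forall fun y => by positivity)
      _ = _ := integral_const_mul _ _
  have hlower : ∀ n : ℕ, Real.exp (-n * c) * K ≤ ∫ y, ‖trialFunction p y₀ (n + 1) y‖ ^ 2 := by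
    intro n
    calc _ = ∫ y in Metric.ball y₀ r, Real.exp (-n * c) * ‖trialFunction p y₀ 1 y‖ ^ 2 :=
          (integral_const_mul _ _).symm
      _ ≤ ∫ y in Metric.ball y₀ r, ‖trialFunction p y₀ (n + 1) y‖ ^ 2 := by
          refine setIntegral_mono_on (hi1.const_mul _).integrableOn
            (integrable_norm_trialFunction_sq hp y₀ (by omega)).integrableOn
            Metric.isOpen_ball.measurableSet fun y hy => ?_
          rw [hstep n y]
          have h1 := hin y hy
          have h2 : (0 : ℝ) ≤ n := n.cast_nonneg
          gcongr ?_ * _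
          exact Real.exp_le_exp.2 (by nlinarith)
      _ ≤ _ := setIntegral_le_integral (integrable_norm_trialFunction_sq hp y₀ (by omega))
          (Eventually.of_forall fun y => by positivity)
  have hlim : Tendsto (fun n : ℕ => Real.exp (-n * c) * I) atTop (nhds 0) := by
    have h1 : Tendsto (fun n : ℕ => -(n : ℝ) * c) atTop atBot :=
      (tendsto_neg_atTop_atBot.comp tendsto_natCast_atTop_atTop).atBot_mul_const hc
    simpa using (Real.tendsto_exp_atBot.comp h1).mul_const I
  obtain ⟨N, hN⟩ := eventually_atTop.1 (hlim.eventually (gt_mem_nhds (mul_pos hε hK0)))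
  refine ⟨N, fun n hn => ?_⟩
  have hE : 0 < Real.exp (-n * c) := Real.exp_pos _
  calc _ ≤ Real.exp (-(2 * n) * c) * I := hupper n
    _ = Real.exp (-n * c) * (Real.exp (-n * c) * I) := by
        rw [← mul_assoc, ← Real.exp_add]; congr 2; ring
    _ < Real.exp (-n * c) * (ε * K) := mul_lt_mul_of_pos_left (hN n hn) hE
    _ = ε * (Real.exp (-n * c) * K) := by ring
    _ ≤ _ := mul_le_mul_of_nonneg_left (hlower n) hε.le

lemma eLpNorm_l2Normalize {f : ℝ → ℂ} (hf : MemLp f 2 volume) (h0 : eLpNorm f 2 volume ≠ 0) :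
    eLpNorm (l2Normalize f) 2 volume = 1 := by
  have e : l2Normalize f = (((eLpNorm f 2 volume).toReal⁻¹ : ℝ) : ℂ) • f := by
    funext y; simp [l2Normalize, mul_comm]
  have hpos : 0 < (eLpNorm f 2 volume).toReal := ENNReal.toReal_pos h0 hf.2.ne
  rw [e, eLpNorm_const_smul, ← ofReal_norm, Complex.norm_real, Real.norm_of_nonneg (by positivity),
    ENNReal.ofReal_inv_of_pos hpos, ENNReal.ofReal_toReal hf.2.ne]
  exact ENNReal.inv_mul_cancel h0 hf.2.ne

lemma ConcentratesAt.l2Normalize {f : ℕ → ℝ → ℂ} {y₀ : ℝ} (hf : ConcentratesAt f y₀)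
    (h0 : ∀ n, eLpNorm (f n) 2 volume ≠ 0) :
    ConcentratesAt (fun n => l2Normalize (f n)) y₀ := by
  refine ⟨fun n => (hf.memLp n).mul_const _, fun ε hε ρ hρ => ?_⟩
  obtain ⟨N, hN⟩ := hf.concentrates ε hε ρ hρ
  refine ⟨N, fun n hn => ?_⟩
  have hpos : 0 < (eLpNorm (f n) 2 volume).toReal := ENNReal.toReal_pos (h0 n) (hf.memLp n).2.ne
  have e : ∀ y, ‖_root_.l2Normalize (f n) y‖ ^ 2 =
      ‖f n y‖ ^ 2 * ((eLpNorm (f n) 2 volume).toReal⁻¹) ^ 2 := by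
    intro y
    rw [_root_.l2Normalize, norm_mul, Complex.norm_real, Real.norm_of_nonneg (by positivity),
      mul_pow]
  simp_rw [e]
  rw [integral_mul_const, integral_mul_const, ← mul_assoc]
  exact mul_lt_mul_of_pos_right (hN n hn) (by positivity)

/-! ### The lower bound for the trial functions -/

/-- Jensen's inequality for three points. -/
lemma three_mul_abs_rpow_le {p : ℝ} (hp : 1 < p) (y : ℝ × ℝ × ℝ) :
    3 * |(y.1 + y.2.1 + y.2.2) / 3| ^ p ≤ |y.1| ^ p + |y.2.1| ^ p + |y.2.2| ^ p := by
  set m := (y.1 + y.2.1 + y.2.2) / 3 with hm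
  have h1 := tangentGap_nonneg hp m y.1
  have h2 := tangentGap_nonneg hp m y.2.1
  have h3 := tangentGap_nonneg hp m y.2.2
  unfold tangentGap at h1 h2 h3
  have h4 : y.1 + y.2.1 + y.2.2 = 3 * m := by rw [hm]; ring
  have h5 : p * oddPow p m * (y.1 - m) + p * oddPow p m * (y.2.1 - m) +
      p * oddPow p m * (y.2.2 - m) = 0 := by
    linear_combination p * oddPow p m * h4
  linarith

/-- The neighbourhood of the lower edge of the range of `curveSum`, of height `t₀` and over the
points `ξ` with `|ξ/3 - y₀| < δ`. -/
def edgeRegion (p y₀ δ t₀ : ℝ) : Set (ℝ × ℝ) :=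
  {x | x.1 ∈ {ξ : ℝ | |ξ / 3 - y₀| < δ} ∧
    3 * |x.1 / 3| ^ p ≤ x.2 ∧ x.2 < 3 * |x.1 / 3| ^ p + t₀}

lemma measurableSet_edgeRegion (p y₀ δ t₀ : ℝ) : MeasurableSet (edgeRegion p y₀ δ t₀) :=
  (measurableSet_lt (f := fun x : ℝ × ℝ => |x.1 / 3 - y₀|) (g := fun _ => δ)
    (by fun_prop) (by fun_prop)).inter
    ((measurableSet_le (f := fun x : ℝ × ℝ => 3 * |x.1 / 3| ^ p) (g := fun x => x.2)
      (by fun_prop) (by fun_prop)).inter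
    (measurableSet_lt (f := fun x : ℝ × ℝ => x.2) (g := fun x => 3 * |x.1 / 3| ^ p + t₀)
      (by fun_prop) (by fun_prop)))

lemma exists_curveSum_mem_edgeRegion {p : ℝ} (hp : 1 < p) (y₀ : ℝ) {δ t₀ : ℝ} (hδ : 0 < δ)
    (ht₀ : 0 < t₀) : ∃ ρ > 0, ∀ y ∈ Metric.ball y₀ ρ ×ˢ Metric.ball y₀ ρ ×ˢ Metric.ball y₀ ρ,
      curveSum p y ∈ edgeRegion p y₀ δ t₀ := by
  have hp0 : 0 ≤ p := by linarith
  have hc : Continuous fun y : ℝ × ℝ × ℝ => |y.1| ^ p + |y.2.1| ^ p + |y.2.2| ^ p -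
      3 * |(y.1 + y.2.1 + y.2.2) / 3| ^ p := by
    have h : Continuous fun x : ℝ => |x| ^ p := continuous_abs.rpow_const fun _ => Or.inr hp0
    exact (((h.comp continuous_fst).add (h.comp (continuous_fst.comp continuous_snd))).add
      (h.comp (continuous_snd.comp continuous_snd))).sub
      (continuous_const.mul (h.comp (by fun_prop : Continuous fun y : ℝ × ℝ × ℝ =>
        (y.1 + y.2.1 + y.2.2) / 3)))
  have h1 : ∀ᶠ y in nhds (y₀, y₀, y₀), |y.1| ^ p + |y.2.1| ^ p + |y.2.2| ^ p -
      3 * |(y.1 + y.2.1 + y.2.2) / 3| ^ p < t₀ := by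
    refine hc.continuousAt.eventually (gt_mem_nhds ?_)
    dsimp only
    rw [show (y₀ + y₀ + y₀) / 3 = y₀ by ring]
    linarith
  have h2 : ∀ᶠ y : ℝ × ℝ × ℝ in nhds (y₀, y₀, y₀), |(y.1 + y.2.1 + y.2.2) / 3 - y₀| < δ := by
    have hc2 : Continuous fun y : ℝ × ℝ × ℝ => |(y.1 + y.2.1 + y.2.2) / 3 - y₀| := by fun_prop
    refine hc2.continuousAt.eventually (gt_mem_nhds ?_)
    dsimp only
    rw [show (y₀ + y₀ + y₀) / 3 - y₀ = 0 by ring, abs_zero]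
    exact hδ
  obtain ⟨ρ, hρ, h⟩ := Metric.eventually_nhds_iff_ball.1 (h1.and h2)
  refine ⟨ρ, hρ, fun y hy => ?_⟩
  rw [ball_prod_same, ball_prod_same] at hy
  obtain ⟨h3, h4⟩ := h y hy
  exact ⟨h4, three_mul_abs_rpow_le hp y, by simp only [curveSum]; linarith⟩

lemma abs_planeUnit_le (θ : ℝ) : |planeUnit₁ θ| ≤ 1 ∧ |planeUnit₂ θ| ≤ 1 ∧ |planeUnit₃ θ| ≤ 1 := by
  have h := planeUnit_sq_sum θ
  refine ⟨?_, ?_, ?_⟩ <;> rw [← sq_le_one_iff_abs_le_one] <;>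
    nlinarith [sq_nonneg (planeUnit₁ θ), sq_nonneg (planeUnit₂ θ), sq_nonneg (planeUnit₃ θ)]

/-- Close to the edge point over `3 y₀`, the triple sum of the squared weight has density at least
`diagConst p / distortion ε`. -/
lemma exists_lintegral_edgeRegion_le {p : ℝ} (hp : 1 < p) {y₀ : ℝ} (hy₀ : y₀ ≠ 0) {ε : ℝ}
    (hε0 : 0 < ε) (hε : ε < 1) : ∃ δ > 0, ∃ t₀ > 0, ∀ Ψ : ℝ × ℝ → ENNReal, Measurable Ψ →
      ENNReal.ofReal (diagConst p / distortion ε) * ∫⁻ x in edgeRegion p y₀ δ t₀, Ψ x ≤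
        ∫⁻ y, ENNReal.ofReal (tripleWeight p y ^ 2) * Ψ (curveSum p y) := by
  obtain ⟨δ, hδ, hW⟩ := exists_isWindow p hy₀ hε0
  set w := |y₀| ^ ((p - 2) / 6) with hw
  set U := Metric.ball y₀ δ with hU
  have hUm : MeasurableSet U := Metric.isOpen_ball.measurableSet
  have hp1 : 0 < p - 1 := by linarith
  have hp0 : 0 < p := by linarith
  have hε1 : 0 < 1 - ε := by linarith
  have hwpos := hW.pos
  set c : ℝ := p * ((p - 1) * ((1 - ε) * w) ^ 6) with hc
  have hc0 : 0 < c := by positivity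
  have hmem : ∀ ξ ∈ {ξ : ℝ | |ξ / 3 - y₀| < δ / 2}, ∀ θ, ∀ r ∈ Set.Icc 0 (δ / 2),
      cylPoint ξ θ r ∈ U ×ˢ U ×ˢ U := by
    intro ξ hξ θ r hr
    have key : ∀ u : ℝ, |u| ≤ 1 → ξ / 3 + r * u ∈ U := by
      intro u hu
      rw [hU, Metric.mem_ball, Real.dist_eq]
      calc |ξ / 3 + r * u - y₀| = |(ξ / 3 - y₀) + r * u| := by ring_nf
        _ ≤ |ξ / 3 - y₀| + |r * u| := abs_add_le _ _
        _ < δ / 2 + δ / 2 := by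
          refine add_lt_add_of_lt_of_le hξ ?_
          rw [abs_mul, abs_of_nonneg hr.1]
          nlinarith [hr.1, hr.2, abs_nonneg u]
        _ = δ := by ring
    obtain ⟨h1, h2, h3⟩ := abs_planeUnit_le θ
    exact ⟨key _ h1, key _ h2, key _ h3⟩
  refine ⟨δ / 2, by positivity, c * (δ / 2) ^ 2 / 2, by positivity, fun Ψ hΨ => ?_⟩
  have hV : MeasurableSet {ξ : ℝ | |ξ / 3 - y₀| < δ / 2} :=
    measurableSet_lt (by fun_prop) (by fun_prop)
  have hmain := setLIntegral_curveSum_ge hp (hUm.prod (hUm.prod hUm)) hV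
    (r₀ := δ / 2) (t₀ := c * (δ / 2) ^ 2 / 2) (by positivity)
    (κ := 1 / (distortion ε * (p * (p - 1)))) (by unfold distortion; positivity)
    (fun ξ hξ θ r hr => hmem ξ hξ θ r (Set.Ioo_subset_Icc_self hr)) ?_ ?_ hΨ
  · refine (le_trans (le_of_eq ?_) hmain).trans (setLIntegral_le_lintegral _ _)
    congr 2
    unfold diagConst
    have : 0 < distortion ε := by unfold distortion; positivity
    field_simp
  · intro y hy
    have h1 := (hW.tripleWeight_sq_mem hε hy).1
    have h2 := (hW.powGap_mem hp hε hy).2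
    have h3 := sqGap_nonneg y
    calc 1 / (distortion ε * (p * (p - 1))) * (p * powGap p y)
        ≤ 1 / (distortion ε * (p * (p - 1))) *
          (p * ((p - 1) * ((1 + ε) * w) ^ 6 * sqGap y)) := by unfold distortion; gcongr
      _ = ((1 - ε) * w) ^ 6 * sqGap y := by unfold distortion; field_simp
      _ ≤ _ := by gcongr
  · -- Along a ray the height grows at least like `c r² / 2`.
    intro ξ hξ θ
    have hmono : MonotoneOn (fun r => rayHeight p ξ θ r - c * r ^ 2 / 2) (Set.Icc 0 (δ / 2)) := by
      have hd : ∀ r, HasDerivAt (fun r => rayHeight p ξ θ r - c * r ^ 2 / 2)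
          (rayHeightDeriv p ξ θ r - c * r) r := by
        intro r
        refine ((hasDerivAt_rayHeight hp ξ θ r).sub
          (((hasDerivAt_pow 2 r).const_mul c).div_const 2)).congr_deriv ?_
        simp; ring
      refine monotoneOn_of_deriv_nonneg (convex_Icc _ _)
        (fun r _ => (hd r).continuousAt.continuousWithinAt)
        (fun r _ => (hd r).differentiableAt.differentiableWithinAt) fun r hr => ?_
      rw [interior_Icc] at hr
      rw [(hd r).deriv]
      have h1 := (hW.powGap_mem hp hε (hmem ξ hξ θ r (Set.Ioo_subset_Icc_self hr))).1
      rw [sqGap_cylPoint] at h1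
      have h2 := mul_rayHeightDeriv p ξ θ r
      have h3 : 0 < 3 * r := by linarith [hr.1]
      have h4 : 3 * r * (c * r) ≤ 3 * r * rayHeightDeriv p ξ θ r := by
        rw [h2, hc]
        calc _ = p * ((p - 1) * ((1 - ε) * w) ^ 6 * (3 * r ^ 2)) := by ring
          _ ≤ _ := by gcongr
      linarith [le_of_mul_le_mul_left h4 h3]
    have h := hmono (Set.left_mem_Icc.2 (by positivity)) (Set.right_mem_Icc.2 (by positivity))
      (by positivity)
    have h0 : rayHeight p ξ θ 0 = 3 * |ξ / 3| ^ p := by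
      simp only [rayHeight, curveSum, cylPoint]; ring_nf
    simp only [h0] at h
    linarith

/-- If the tensor cube of `f` is the weight times a function `a` of the triple sum, then `a`,
restricted to the edge region, is a nearly optimal test function. -/
lemma le_tripleConvNorm_sq {p : ℝ} (hp : 1 < p) {f : ℝ → ℂ} (hf : MemLp f 2 volume)
    {a : ℝ × ℝ → ℝ} (ha : Measurable a)
    (hfa : ∀ y, tensorCube f y = ((a (curveSum p y) * tripleWeight p y : ℝ) : ℂ))
    {S : Set (ℝ × ℝ)} (hS : MeasurableSet S) {c : ℝ} (hc : 0 < c)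
    (hcS : ∀ Ψ : ℝ × ℝ → ENNReal, Measurable Ψ → ENNReal.ofReal c * ∫⁻ x in S, Ψ x ≤
        ∫⁻ y, ENNReal.ofReal (tripleWeight p y ^ 2) * Ψ (curveSum p y)) :
    ENNReal.ofReal c * ∫⁻ y in curveSum p ⁻¹' S, ‖tensorCube f y‖ₑ ^ 2 ≤
      tripleConvNorm p f ^ 2 := by
  set φ : ℝ × ℝ → ℂ := S.indicator fun x => (a x : ℂ) with hφdef
  have hφ : Measurable φ := (Complex.measurable_ofReal.comp ha).indicator hS
  have hπS : MeasurableSet (curveSum p ⁻¹' S) := measurable_curveSum p hS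
  set I := ∫⁻ y in curveSum p ⁻¹' S, ‖tensorCube f y‖ₑ ^ 2 with hI
  have hItop : I ≠ ⊤ := by
    refine ne_top_of_le_ne_top ?_ (setLIntegral_le_lintegral _ _)
    rw [lintegral_enorm_tensorCube_sq hf.1]
    exact ENNReal.pow_ne_top hf.2.ne
  have hpt : ∀ y, ENNReal.ofReal (tripleWeight p y ^ 2) * ‖φ (curveSum p y)‖ₑ ^ 2 =
      (curveSum p ⁻¹' S).indicator (fun y => ‖tensorCube f y‖ₑ ^ 2) y := by
    intro y
    by_cases hy : curveSum p y ∈ S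
    · rw [Set.indicator_of_mem (show y ∈ curveSum p ⁻¹' S from hy), hφdef,
        Set.indicator_of_mem hy, hfa, ENNReal.ofReal_pow (tripleWeight_nonneg p y), ← mul_pow,
        Complex.ofReal_mul, enorm_mul, mul_comm]
      congr 3
      rw [← ofReal_norm, Complex.norm_real, Real.norm_of_nonneg (tripleWeight_nonneg p y)]
    · rw [Set.indicator_of_notMem (show y ∉ curveSum p ⁻¹' S from hy), hφdef,
        Set.indicator_of_notMem hy]
      simp
  -- The lower bound for the density controls the norm of the test function.
  have hφI : ENNReal.ofReal c * eLpNorm φ 2 volume ^ 2 ≤ I := by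
    have h1 := hcS (fun x => ‖φ x‖ₑ ^ 2) (by fun_prop)
    simp_rw [hpt] at h1
    rw [lintegral_indicator hπS] at h1
    refine le_trans (le_of_eq ?_) h1
    rw [eLpNorm_two_sq, ← lintegral_indicator hS]
    congr 1
    refine lintegral_congr fun x => ?_
    by_cases hx : x ∈ S <;> simp [hφdef, hx]
  have hφ2 : MemLp φ 2 volume := by
    refine ⟨hφ.aestronglyMeasurable, ?_⟩
    by_contra h
    rw [not_lt, top_le_iff] at h
    rw [h, ENNReal.top_pow two_ne_zero, ENNReal.mul_top (by simpa using hc)] at hφI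
    exact hItop (top_le_iff.1 hφI)
  have hfun : tripleFunctional p f φ = (I.toReal : ℂ) := by
    have h1 : ∀ y, φ (curveSum p y) * (tripleWeight p y * tensorCube f y) =
        (((curveSum p ⁻¹' S).indicator (fun y => ‖tensorCube f y‖ ^ 2) y : ℝ) : ℂ) := by
      intro y
      by_cases hy : curveSum p y ∈ S
      · rw [Set.indicator_of_mem (show y ∈ curveSum p ⁻¹' S from hy), hφdef,
          Set.indicator_of_mem hy, hfa, Complex.norm_real, Real.norm_eq_abs, sq_abs]
        push_cast; ring
      · rw [Set.indicator_of_notMem (show y ∉ curveSum p ⁻¹' S from hy), hφdef,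
          Set.indicator_of_notMem hy]
        simp
    rw [tripleFunctional]
    simp_rw [h1]
    rw [integral_complex_ofReal, integral_indicator hπS, integral_eq_lintegral_of_nonneg_ae
      (f := fun y => ‖tensorCube f y‖ ^ 2) (Eventually.of_forall fun y => by positivity)
      ((aestronglyMeasurable_tensorCube hf.1).norm.pow 2).restrict]
    congr 2
    refine lintegral_congr fun y => ?_
    rw [ENNReal.ofReal_pow (norm_nonneg _), ofReal_norm]
  have hle := enorm_tripleFunctional_le hp hf hφ hφ2
  rw [hfun, ← ofReal_norm, Complex.norm_real, Real.norm_of_nonneg ENNReal.toReal_nonneg,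
    ENNReal.ofReal_toReal hItop] at hle
  rcases eq_or_ne I 0 with h0 | h0
  · rw [h0]; simp
  refine (ENNReal.mul_le_mul_iff_left h0 hItop).1 ?_
  calc ENNReal.ofReal c * I * I = ENNReal.ofReal c * I ^ 2 := by ring
    _ ≤ ENNReal.ofReal c * (tripleConvNorm p f ^ 2 * eLpNorm φ 2 volume ^ 2) := by gcongr
    _ = tripleConvNorm p f ^ 2 * (ENNReal.ofReal c * eLpNorm φ 2 volume ^ 2) := by ring
    _ ≤ tripleConvNorm p f ^ 2 * I := by gcongr

/-- The tensor cube of a trial function depends on `y` only through the triple sum, up to the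
weight, because the exponent is affine along the curve. -/
lemma tensorCube_l2Normalize_trialFunction (p y₀ : ℝ) (n : ℕ) : ∃ a : ℝ × ℝ → ℝ, Measurable a ∧
    ∀ y, tensorCube (l2Normalize (trialFunction p y₀ n)) y =
      ((a (curveSum p y) * tripleWeight p y : ℝ) : ℂ) := by
  set s := (eLpNorm (trialFunction p y₀ n) 2 volume).toReal⁻¹ with hs
  refine ⟨fun x => s ^ 3 * Real.exp (-n * (x.2 - 3 * |y₀| ^ p - p * oddPow p y₀ * (x.1 - 3 * y₀))),
    by fun_prop, fun y => ?_⟩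
  have hexp : Real.exp (-n * ((curveSum p y).2 - 3 * |y₀| ^ p -
      p * oddPow p y₀ * ((curveSum p y).1 - 3 * y₀))) = Real.exp (-n * tangentGap p y₀ y.1) *
      Real.exp (-n * tangentGap p y₀ y.2.1) * Real.exp (-n * tangentGap p y₀ y.2.2) := by
    rw [← Real.exp_add, ← Real.exp_add]
    congr 1
    simp only [curveSum, tangentGap]; ring
  dsimp only
  rw [hexp]
  simp only [tensorCube, l2Normalize, trialFunction_eq, ← hs, tripleWeight]
  push_cast
  ring

theorem le_limsup_convRatio_trialFunction {p : ℝ} (hp : 1 < p) {y₀ : ℝ} (hy₀ : y₀ ≠ 0) :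
    ENNReal.ofReal (diagConst p) ≤
      limsup (fun n => convRatio p (l2Normalize (trialFunction p y₀ (n + 1)))) atTop := by
  have h0 : ∀ n : ℕ, eLpNorm (trialFunction p y₀ (n + 1)) 2 volume ≠ 0 := fun n =>
    eLpNorm_trialFunction_ne_zero hp y₀ (by omega)
  have hconc := (concentratesAt_trialFunction hp y₀).l2Normalize h0
  set L := limsup (fun n => convRatio p (l2Normalize (trialFunction p y₀ (n + 1)))) atTop with hL
  have key : ∀ ε ∈ Set.Ioo (0 : ℝ) 1,
      ENNReal.ofReal (diagConst p / distortion ε * (1 - ε) ^ 3) ≤ L := by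
    intro ε hε
    have hε1 : 0 < 1 - ε := by linarith [hε.2]
    have hd : 0 < distortion ε := by
      have := hε.1
      unfold distortion; positivity
    have hD := diagConst_pos hp
    obtain ⟨δ, hδ, t₀, ht₀, hlow⟩ := exists_lintegral_edgeRegion_le hp hy₀ hε.1 hε.2
    obtain ⟨ρ, hρ, hball⟩ := exists_curveSum_mem_edgeRegion hp y₀ hδ ht₀
    refine le_limsup_of_frequently_le (Eventually.frequently ?_) (by isBoundedDefault)
    filter_upwards [hconc.eventually_lintegral_le hε.1 hρ] with n hn
    set F := l2Normalize (trialFunction p y₀ (n + 1)) with hF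
    have hFm : MemLp F 2 volume := hconc.memLp n
    have hF1 : eLpNorm F 2 volume = 1 :=
      eLpNorm_l2Normalize (memLp_trialFunction hp y₀ (by omega)) (h0 n)
    obtain ⟨a, ha, hFa⟩ := tensorCube_l2Normalize_trialFunction p y₀ (n + 1)
    have hmain := le_tripleConvNorm_sq hp hFm ha hFa (measurableSet_edgeRegion p y₀ δ t₀)
      (div_pos hD hd) hlow
    have hmass : ENNReal.ofReal (1 - ε) ≤ ∫⁻ x in Metric.ball y₀ ρ, ‖F x‖ₑ ^ 2 := by
      have h1 := lintegral_add_compl (μ := volume) (fun x => ‖F x‖ₑ ^ 2)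
        (Metric.isOpen_ball (x := y₀) (ε := ρ)).measurableSet
      rw [← eLpNorm_two_sq (μ := volume), hF1, one_pow, mul_one] at hn
      rw [← eLpNorm_two_sq (μ := volume), hF1, one_pow] at h1
      rw [ENNReal.ofReal_sub _ hε.1.le, ENNReal.ofReal_one, ← h1]
      exact tsub_le_iff_right.2 (by gcongr)
    rw [convRatio, hF1, one_pow, div_one, ENNReal.ofReal_mul (by positivity),
      ENNReal.ofReal_pow hε1.le]
    refine le_trans ?_ hmain
    gcongr
    calc ENNReal.ofReal (1 - ε) ^ 3 ≤ (∫⁻ x in Metric.ball y₀ ρ, ‖F x‖ₑ ^ 2) ^ 3 := by gcongr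
      _ = ∫⁻ y in Metric.ball y₀ ρ ×ˢ Metric.ball y₀ ρ ×ˢ Metric.ball y₀ ρ,
          ‖tensorCube F y‖ₑ ^ 2 := by
          simp_rw [enorm_tensorCube_sq]
          rw [setLIntegral_prod_three (hFm.1.enorm.pow_const 2)]
          ring
      _ ≤ _ := lintegral_mono_set fun y hy => hball y hy
  have ht : Tendsto (fun ε : ℝ => ENNReal.ofReal (diagConst p / distortion ε * (1 - ε) ^ 3))
      (nhdsWithin 0 (Set.Ioi 0)) (nhds (ENNReal.ofReal (diagConst p))) := by
    have h1 : ContinuousAt (fun ε : ℝ => diagConst p / distortion ε * (1 - ε) ^ 3) 0 :=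
      (continuousAt_const.div continuousAt_distortion (by simp [distortion_zero])).mul
        ((continuousAt_const.sub continuousAt_id).pow 3)
    have h2 := ENNReal.tendsto_ofReal h1.tendsto
    simp only [distortion_zero, div_one, sub_zero, one_pow, mul_one] at h2
    exact h2.mono_left nhdsWithin_le_nhds
  refine le_of_tendsto ht ?_
  filter_upwards [Ioo_mem_nhdsGT (show (0 : ℝ) < 1 by norm_num)] with ε hε
  exact key ε hε

theorem mainTheorem11 (p : ℝ) (hp : 1 < p) (y₀ : ℝ) (hy₀ : y₀ ≠ 0) :
    (∀ f : ℕ → ℝ → ℂ, ConcentratesAt f y₀ →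
      limsup (fun n => convRatio p (f n)) atTop
        ≤ ENNReal.ofReal (2 * Real.pi / (Real.sqrt 3 * p * (p - 1)))) ∧
    (∀ n : ℕ, 1 ≤ n → MemLp (trialFunction p y₀ n) 2 volume ∧
      eLpNorm (trialFunction p y₀ n) 2 volume ≠ 0) ∧
    ConcentratesAt (fun n => l2Normalize (trialFunction p y₀ (n + 1))) y₀ ∧
    limsup (fun n => convRatio p (l2Normalize (trialFunction p y₀ (n + 1)))) atTop
      = ENNReal.ofReal (2 * Real.pi / (Real.sqrt 3 * p * (p - 1))) := by
  have hconc := (concentratesAt_trialFunction hp y₀).l2Normalize fun n =>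
    eLpNorm_trialFunction_ne_zero hp y₀ (by omega)
  exact ⟨fun f hf => limsup_convRatio_le hp hy₀ hf,
    fun n hn => ⟨memLp_trialFunction hp y₀ hn, eLpNorm_trialFunction_ne_zero hp y₀ hn⟩, hconc,
    le_antisymm (limsup_convRatio_le hp hy₀ hconc) (le_limsup_convRatio_trialFunction hp hy₀)⟩
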